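/- **Proposition (blow-up of the Brockett–Wegner flow).** For unbounded operators on a Hilbert space, products and commutators $[A,B]=AB-BA$ are taken on their natural domains. Let $X$ and $Y_t$, $t\in[0,T)$, be closed operators and let $\mathcal C\subseteq\mathcal D$ be subspaces. We say that $(Y_t)_{t\in[0,T)}$ is a *local solution on $\mathcal D$, with core $\mathcal C$*, of the Brockett–Wegner flow $\partial_tY_t=[Y_t,[Y_t,X]]$ if * $\mathcal C$ is a core of $X$ and of every $Y_t$; * for $\varphi\in\mathcal C$ the vector $[Y_t,[Y_t,X]]\varphi$ is defined for every $t\in[0,T)$, and $t\mapsto Y_t\varphi$ is norm-differentiable on $[0,T)$ with derivative $[Y_t,[Y_t,X]]\varphi$; * for every $\varphi\in\mathcal D$ one has $\varphi\in\mathcal D(Y_t)$ for all $t\in[0,T)$, and $t\mapsto Y_t\varphi$ is norm-differentiable on $[0,T)$ with derivative $\overline{[Y_t,[Y_t,X]]}\,\varphi$ (the bar denotes the closure). **(i)** There exist a separable complex Hilbert space, a time $T_{\max}\in(0,\infty)$, an unbounded self-adjoint operator $X\ge 0$ and unbounded self-adjoint operators $(Y_t)_{t\in[0,T_{\max})}$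 with $\mathcal D(Y_t)=\mathcal D(Y_0)$ for all $t\in[0,T_{\max})$, which are a local solution of the Brockett–Wegner flow on $\mathcal D(Y_0)$ with some core $\mathcal C$, such that $$\lim_{t\nearrow T_{\max}}\|Y_t\varphi\|=\infty\qquad\text{for every non-zero }\varphi\in\mathcal D(Y_0).$$ **(ii)** Two-mode example. Let $a_\pm,a_\pm^*$ be the annihilation and creation operators of two boson modes on the boson Fock space over $\mathbb C^2$, let $\mathcal C$ be the subspace of vectors with boundedly many particles, and let $X=\mathrm N$ be the closure of $a_-^*a_-+a_+^*a_+$ on $\mathcal C$. For real $\omega_-,\omega_+,b,c$ let $H(\omega_-,\omega_+,b,c)$ be the closure of the operator $$\omega_-a_-^*a_-+\omega_+a_+^*a_++2b\,(a_+^*a_-^*+a_-a_+)+c$$ on $\mathcal C$, that is, of the quadratic operator $\sum_{k,\ell}\Omega_{k\ell}a_k^*a_\ell+B_{k\ell}a_k^*a_\ell^*+\overline{B_{k\ell}}a_ka_\ell+c$ with $\Omega=\begin{pmatrix}\omega_-&0\\0&\omega_+\end{pmatrix}$ and $B=\begin{pmatrix}0&b\\b&0\end{pmatrix}$. For every $b>0$,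 with $T_{\max}=\pi/(16b)$, there are real functions $\omega_{\pm,t},b_t,c_t$ with $\omega_{\pm,0}=0$, $b_0=b$, $c_0=0$ such that, for $Y_t:=H(\omega_{-,t},\omega_{+,t},b_t,c_t)$: the operator $X\ge0$ and all $Y_t$, $t\in[0,T_{\max})$, are self-adjoint and unbounded; all $Y_t$ have the common core $\mathcal C$, and $\mathcal D(\mathrm N)\subseteq\mathcal D(Y_t)$; $(Y_t)_{t\in[0,T_{\max})}$ is a local solution of the Brockett–Wegner flow on $\mathcal D(\mathrm N)$ with core $\mathcal C$; and $\lim_{t\nearrow T_{\max}}\|Y_t\varphi\|=\infty$ for every non-zero $\varphi\in\mathcal D(\mathrm N)$. -/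

import Mathlib

open Filter Topology

/-! ### Unbounded operators -/

section Operators

variable {F : Type*} [NormedAddCommGroup F] [InnerProductSpace ℂ F]

/-- The product `A B` of two unbounded operators on its natural domain
`{x ∈ D(B) | B x ∈ D(A)}`. -/
noncomputable def LinearPMap.mulOp (A B : F →ₗ.[ℂ] F) : F →ₗ.[ℂ] F :=
  A.comp (B.domRestrict ((A.domain.comap B.toFun).map B.domain.subtype)) (by
    rintro ⟨x, hx, hxB⟩
    obtain ⟨y, hy, hyx⟩ := hx
    have h : (B.domRestrict ((A.domain.comap B.toFun).map B.domain.subtype))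
        ⟨x, ⟨⟨y, hy, hyx⟩, hxB⟩⟩ = B y :=
      LinearPMap.domRestrict_apply hyx.symm
    rw [h]
    exact hy)

/-- The commutator `[A, B] = A B - B A` on its natural domain `D(A B) ∩ D(B A)`. -/
noncomputable def LinearPMap.commOp (A B : F →ₗ.[ℂ] F) : F →ₗ.[ℂ] F :=
  A.mulOp B - B.mulOp A

/-- The operator is unbounded. -/
def LinearPMap.IsUnbounded (A : F →ₗ.[ℂ] F) : Prop :=
  ¬ ∃ C : ℝ, ∀ x : A.domain, ‖A x‖ ≤ C * ‖(x : F)‖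

/-- `0 ≤ A` in the sense of quadratic forms. -/
def LinearPMap.IsNonneg (A : F →ₗ.[ℂ] F) : Prop :=
  ∀ x : A.domain, 0 ≤ (inner ℂ (x : F) (A x)).re

/-- `(Y t)` for `t ∈ [0, T)` solves the Brockett-Wegner flow `∂ₜ Y = [Y, [Y, X]]`:
* the subspace `C ≤ D` is a core of `X` and of every `Y t`;
* on `C` the double commutator is defined as it stands, and for `φ ∈ C` the curve `t ↦ Y t φ` is
  norm-differentiable with derivative `[Y t, [Y t, X]] φ`;
* every `φ ∈ D` lies in the domain of every `Y t`, and `t ↦ Y t φ` is norm-differentiable, the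
  derivative being given by the closure of the operator `[Y t, [Y t, X]]`. -/
structure IsLocalFlow (X : F →ₗ.[ℂ] F) (Y : ℝ → F →ₗ.[ℂ] F) (T : ℝ)
    (C D : Submodule ℂ F) : Prop where
  core_le : C ≤ D
  core_X : X.HasCore C
  core_Y : ∀ t ∈ Set.Ico 0 T, (Y t).HasCore C
  flow_core : ∀ φ ∈ C, ∃ u v : ℝ → F, ∀ t ∈ Set.Ico 0 T,
    (φ, u t) ∈ (Y t).graph ∧
    (φ, v t) ∈ ((Y t).commOp ((Y t).commOp X)).graph ∧
    HasDerivWithinAt u (v t) (Set.Ico 0 T) t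
  flow_dom : ∀ φ ∈ D, ∃ u v : ℝ → F, ∀ t ∈ Set.Ico 0 T,
    (φ, u t) ∈ (Y t).graph ∧
    (φ, v t) ∈ ((Y t).commOp ((Y t).commOp X)).graph.topologicalClosure ∧
    HasDerivWithinAt u (v t) (Set.Ico 0 T) t

/-- For every non-zero `φ ∈ D` (which lies in all the domains `D(Y t)`, `0 ≤ t < T`),
`‖Y t φ‖ → ∞` as `t ↗ T`. -/
def BlowsUpOn (Y : ℝ → F →ₗ.[ℂ] F) (T : ℝ) (D : Submodule ℂ F) : Prop :=
  ∀ φ ∈ D, φ ≠ 0 → ∃ u : ℝ → F, (∀ t ∈ Set.Ico 0 T, (φ, u t) ∈ (Y t).graph) ∧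
    Tendsto (fun t => ‖u t‖) (𝓝[<] T) atTop

end Operators

/-! ### Quadratic boson operators with finitely many modes -/

section Bosons

variable (ι : Type*)

/-- The boson Fock space over the one-particle space `ℂ^ι`, in the occupation number
representation: `ψ n` is the component of `ψ` along the normalized state with `n k` particles in
the mode `k`. -/
noncomputable abbrev BosonFock := lp (fun _ : ι → ℕ => ℂ) 2

/-- The vectors with boundedly many particles. As there are finitely many modes, these are the
finite combinations of occupation number states. -/
noncomputable def finiteParticle : Submodule ℂ (BosonFock ι) where
  carrier := {ψ | {n | (ψ : (ι → ℕ) → ℂ) n ≠ 0}.Finite}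
  zero_mem' := by simp
  add_mem' {ψ χ} hψ hχ := by
    refine (hψ.union hχ).subset fun n hn => ?_
    by_contra h
    simp only [Set.mem_union, Set.mem_ofPred_eq, not_or, not_not] at h
    exact hn (by simp [h.1, h.2])
  smul_mem' c ψ hψ := by
    refine hψ.subset fun n hn h => hn ?_
    simp [h]

variable {ι} [Fintype ι] [DecidableEq ι]

/-- An operation on coefficient families that preserves finite support, as an operator on
`finiteParticle`. -/
noncomputable def ofCoeff (L : ((ι → ℕ) → ℂ) →ₗ[ℂ] ((ι → ℕ) → ℂ))
    (hL : ∀ f, {n | f n ≠ 0}.Finite → {n | L f n ≠ 0}.Finite) :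
    Module.End ℂ (finiteParticle ι) where
  toFun ψ := ⟨⟨L (ψ : BosonFock ι), (memℓp_zero (hL _ ψ.2)).of_exponent_ge zero_le⟩, hL _ ψ.2⟩
  map_add' ψ χ := by
    ext n
    exact congrFun (L.map_add (ψ : BosonFock ι) (χ : BosonFock ι)) n
  map_smul' c ψ := by
    ext n
    exact congrFun (L.map_smul c (ψ : BosonFock ι)) n

/-- The annihilation operator `a_k`: `a_k |n⟩ = √(n k) |n - e_k⟩`, that is,
`(a_k ψ) n = √(n k + 1) ψ (n + e_k)`. -/
noncomputable def annihilate (k : ι) : Module.End ℂ (finiteParticle ι) :=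
  ofCoeff
    { toFun := fun f n => (Real.sqrt (n k + 1) : ℂ) * f (n + Pi.single k 1)
      map_add' := fun f g => by ext n; simp [mul_add]
      map_smul' := fun c f => by ext n; simp [mul_left_comm] }
    (fun f hf => by
      have hinj : Function.Injective fun n : ι → ℕ => n + Pi.single k 1 :=
        add_left_injective _
      refine (hf.preimage hinj.injOn).subset fun n hn h => hn ?_
      simp [h])

/-- The creation operator `a_k^*`: `a_k^* |n⟩ = √(n k + 1) |n + e_k⟩`, that is,
`(a_k^* ψ) n = √(n k) ψ (n - e_k)`, which is zero if `n k = 0`. -/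
noncomputable def create (k : ι) : Module.End ℂ (finiteParticle ι) :=
  ofCoeff
    { toFun := fun f n => (Real.sqrt (n k) : ℂ) * f (n - Pi.single k 1)
      map_add' := fun f g => by ext n; simp [mul_add]
      map_smul' := fun c f => by ext n; simp [mul_left_comm] }
    (fun f hf => by
      refine (hf.image fun n => n + Pi.single k 1).subset fun n hn => ?_
      have hk : n k ≠ 0 := fun h => hn (by simp [h])
      refine ⟨n - Pi.single k 1, fun h => hn (by simp [h]), ?_⟩
      ext j
      by_cases hj : j = k
      · subst hj
        simp
        omega
      · simp [hj])

/-- The operator on the Fock space with domain `finiteParticle` given by `A`. -/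
noncomputable def onFock (A : Module.End ℂ (finiteParticle ι)) :
    BosonFock ι →ₗ.[ℂ] BosonFock ι where
  domain := finiteParticle ι
  toFun := (finiteParticle ι).subtype ∘ₗ A

/-- The particle number operator `∑ₖ a_k^* a_k` on `finiteParticle`. -/
noncomputable def numberOp (ι : Type*) [Fintype ι] [DecidableEq ι] :
    BosonFock ι →ₗ.[ℂ] BosonFock ι :=
  onFock (∑ k, create k * annihilate k)

/-- The quadratic boson operator
`∑ₖₗ Ωₖₗ a_k^* a_l + Bₖₗ a_k^* a_l^* + conj(Bₖₗ) a_k a_l + C` on `finiteParticle`. -/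
noncomputable def quadraticOp (Ω B : Matrix ι ι ℂ) (C : ℝ) :
    BosonFock ι →ₗ.[ℂ] BosonFock ι :=
  onFock ((∑ k, ∑ l, (Ω k l • (create k * annihilate l) + B k l • (create k * create l)
      + (starRingEnd ℂ (B k l)) • (annihilate k * annihilate l)))
    + (C : ℂ) • 1)

/-- The two-mode quadratic operator with `Ω = diag(ω₁, ω₂)` and `B` the real symmetric matrix with
zero diagonal and off-diagonal entry `b`, that is,
`ω₁ a₁^* a₁ + ω₂ a₂^* a₂ + 2 b (a₁^* a₂^* + a₂ a₁) + c`. -/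
noncomputable def twoModeOp (ω₁ ω₂ b c : ℝ) : BosonFock (Fin 2) →ₗ.[ℂ] BosonFock (Fin 2) :=
  quadraticOp !![(ω₁ : ℂ), 0; 0, (ω₂ : ℂ)] !![0, (b : ℂ); (b : ℂ), 0] c

end Bosons

/-!
The quadratic expressions `a₀ a₁`, `a₀^* a₁^*` and `M = N + 1` satisfy the `su(1,1)` relations
`[a₀ a₁, a₀^* a₁^*] = M`, `[a₀ a₁, M] = 2 a₀ a₁`, `[a₀^* a₁^*, M] = -2 a₀^* a₁^*`. On operators
`Y = ω M + 2 β (a₀ a₁ + a₀^* a₁^*)` the flow therefore becomes the system `ω' = -16 β ^ 2`,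
`β' = -4 ω β`, along which `ω ^ 2 - 4 β ^ 2` is conserved. The parabolic solutions, with
`ω = -2 β`, give `Y t = r t • Y₀` with constant domain; the solution with `ω = 0` at time `0` is
`ω = -2 b tan (8 b t)`, `β = b / cos (8 b t)`. In both cases the direction of `Y t` tends to
`a₀ a₁ + a₀^* a₁^* - M` while its size tends to infinity, so `‖Y t φ‖ → ∞` unless `φ` is in the
kernel of this operator. The kernel is trivial: along the states with a fixed difference of
occupation numbers, the coefficients of such a `φ` are non-decreasing in modulus, and they are
square-summable.

Domains and closures are controlled by realizing all operators as continuous maps on arbitrary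
coefficient families, where algebraic identities hold without domain restrictions. A quadratic
operator is then the maximal one, because multiplying by a cutoff in `N / k` approximates graphs of
the maximal operator: by the canonical commutation relations the commutator with the cutoff is
bounded uniformly in `k`. This gives self-adjointness as well as the closure of the double
commutator.
-/

section UnboundedOperators

variable {F : Type*} [NormedAddCommGroup F] [InnerProductSpace ℂ F]

theorem mem_graph_mulOp {A B : F →ₗ.[ℂ] F} {x y z : F} (hB : (x, y) ∈ B.graph)
    (hA : (y, z) ∈ A.graph) : (x, z) ∈ (A.mulOp B).graph := by
  obtain ⟨⟨x, hx⟩, rfl, rfl⟩ := (LinearPMap.mem_graph_iff B).1 hB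
  obtain ⟨⟨_, hBx⟩, rfl, hz⟩ := (LinearPMap.mem_graph_iff A).1 hA
  exact (LinearPMap.mem_graph_iff _).2 ⟨⟨x, ⟨⟨x, hx⟩, hBx, rfl⟩, hx⟩, rfl, hz⟩

theorem mem_graph_sub {A B : F →ₗ.[ℂ] F} {x y z : F} (hA : (x, y) ∈ A.graph)
    (hB : (x, z) ∈ B.graph) : (x, y - z) ∈ (A - B).graph := by
  obtain ⟨⟨x, hxA⟩, rfl, rfl⟩ := (LinearPMap.mem_graph_iff A).1 hA
  obtain ⟨⟨_, hxB⟩, rfl, rfl⟩ := (LinearPMap.mem_graph_iff B).1 hB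
  exact (LinearPMap.mem_graph_iff _).2 ⟨⟨_, hxA, hxB⟩, rfl, LinearPMap.sub_apply _ _ _⟩

theorem mem_graph_commOp {A B : F →ₗ.[ℂ] F} {S : Submodule ℂ F} {a b : Module.End ℂ S}
    (hA : ∀ x : S, ((x : F), (a x : F)) ∈ A.graph) (hB : ∀ x : S, ((x : F), (b x : F)) ∈ B.graph)
    (x : S) : ((x : F), (⁅a, b⁆ x : F)) ∈ (A.commOp B).graph :=
  mem_graph_sub (mem_graph_mulOp (hB x) (hA (b x))) (mem_graph_mulOp (hA x) (hB (a x)))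

theorem adjoint_topologicalClosure (g : Submodule ℂ (F × F)) :
    g.topologicalClosure.adjoint = g.adjoint := by
  ext ⟨x, y⟩
  simp only [Submodule.mem_adjoint_iff]
  refine ⟨fun h a b hab => h a b (g.le_topologicalClosure hab), fun h a b hab => ?_⟩
  have hclosed : IsClosed {p : F × F | inner ℂ p.2 x - inner ℂ p.1 y = 0} :=
    isClosed_eq (by fun_prop) continuous_const
  exact closure_minimal (fun p hp => h p.1 p.2 hp) hclosed hab

variable [CompleteSpace F] {A : F →ₗ.[ℂ] F}

theorem isClosable_of_isFormalAdjoint_self (hdense : Dense (A.domain : Set F))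
    (hA : A.IsFormalAdjoint A) : A.IsClosable :=
  (LinearPMap.adjoint_isClosed hdense).isClosable.leIsClosable
    (LinearPMap.IsFormalAdjoint.le_adjoint hdense hA)

theorem isSelfAdjoint_closure_of_graph_adjoint_le (hdense : Dense (A.domain : Set F))
    (hA : A.IsFormalAdjoint A) (h : A.adjoint.graph ≤ A.graph.topologicalClosure) :
    IsSelfAdjoint A.closure := by
  have hclosure := (isClosable_of_isFormalAdjoint_self hdense hA).graph_closure_eq_closure_graph
  have hge : A.graph.topologicalClosure ≤ A.adjoint.graph :=
    Submodule.topologicalClosure_minimal _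
      (LinearPMap.le_graph_iff.2 (LinearPMap.IsFormalAdjoint.le_adjoint hdense hA))
      (LinearPMap.adjoint_isClosed hdense)
  rw [LinearPMap.isSelfAdjoint_def]
  refine LinearPMap.eq_of_eq_graph ?_
  rw [LinearPMap.adjoint_graph_eq_graph_adjoint (hdense.mono A.le_closure.1), ← hclosure,
    adjoint_topologicalClosure, ← LinearPMap.adjoint_graph_eq_graph_adjoint hdense]
  exact h.antisymm hge

end UnboundedOperators

section SummablePowers

open scoped ENNReal

variable {α : Type*}

theorem memℓp_of_comp {β : Type*} {E : Type*} [NormedAddCommGroup E] {p : ℝ≥0∞}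
    (hp : 0 < p.toReal) {e : β → α} (he : Function.Injective e) {f : α → E}
    (hf : ∀ a ∉ Set.range e, f a = 0) (h : Memℓp (f ∘ e) p) : Memℓp f p := by
  rw [memℓp_gen_iff hp] at h ⊢
  refine (he.summable_iff fun a ha => ?_).1 h
  rw [hf a ha, norm_zero, Real.zero_rpow hp.ne']

theorem memℓp_comp {β : Type*} {E : Type*} [NormedAddCommGroup E] {p : ℝ≥0∞}
    (hp : 0 < p.toReal) {e : β → α} (he : Function.Injective e) {f : α → E}
    (h : Memℓp f p) : Memℓp (f ∘ e) p :=
  (memℓp_gen_iff hp).2 (((memℓp_gen_iff hp).1 h).comp_injective he)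

variable {E : α → Type*} [∀ i, NormedAddCommGroup (E i)] {p : ℝ≥0∞}

theorem tendsto_norm_lp_cofinite (hp : 0 < p.toReal) (f : lp E p) :
    Tendsto (fun i => ‖f i‖) cofinite (𝓝 0) := by
  have h := ((memℓp_gen_iff hp).1 (lp.memℓp f)).tendsto_cofinite_zero
  simpa [← Real.rpow_mul (norm_nonneg _), hp.ne'] using
    h.rpow_const (p := p.toReal⁻¹) (.inr (by positivity))

variable [Fact (1 ≤ p)]

theorem tendsto_lp_of_dominated (hp : 0 < p.toReal) {κ : Type*} {l : Filter κ} {f : κ → lp E p}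
    {f₀ : lp E p} {g : α → ℝ} (hg : Memℓp g p) (hfg : ∀ k i, ‖f k i - f₀ i‖ ≤ g i)
    (hf : ∀ i, Tendsto (fun k => f k i) l (𝓝 (f₀ i))) : Tendsto f l (𝓝 f₀) := by
  have hpow (i : α) : Tendsto (fun k => ‖f k i - f₀ i‖ ^ p.toReal) l (𝓝 0) := by
    simpa [Real.zero_rpow hp.ne'] using
      (tendsto_iff_norm_sub_tendsto_zero.1 (hf i)).rpow_const (.inr hp.le)
  have hbound (k : κ) (i : α) : ‖‖f k i - f₀ i‖ ^ p.toReal‖ ≤ ‖g i‖ ^ p.toReal := by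
    rw [Real.norm_of_nonneg (by positivity)]
    exact Real.rpow_le_rpow (norm_nonneg _) ((hfg k i).trans (le_abs_self _)) hp.le
  have hsum : Tendsto (fun k => ‖f k - f₀‖ ^ p.toReal) l (𝓝 0) := by
    have h := tendsto_tsum_of_dominated_convergence ((memℓp_gen_iff hp).1 hg) hpow
      (Eventually.of_forall hbound)
    simpa only [lp.norm_rpow_eq_tsum hp, lp.coeFn_sub, Pi.sub_apply, tsum_zero] using h
  rw [tendsto_iff_norm_sub_tendsto_zero]
  simpa [← Real.rpow_mul (norm_nonneg _), hp.ne'] using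
    hsum.rpow_const (p := p.toReal⁻¹) (.inr (by positivity))

theorem separableSpace_lp [Countable α] [∀ i, NormedSpace ℝ (E i)]
    [∀ i, TopologicalSpace.SeparableSpace (E i)] (hp : p ≠ ∞) :
    TopologicalSpace.SeparableSpace (lp E p) := by
  classical
  let s : Set (lp E p) := ⋃ i, Set.range (lp.single p i)
  have hs : TopologicalSpace.IsSeparable s := by
    refine .iUnion fun i => TopologicalSpace.isSeparable_range ?_
    exact (lp.singleContinuousAddMonoidHom E p i).continuous
  refine TopologicalSpace.isSeparable_univ_iff.1 ((hs.span (R := ℝ)).closure.mono fun f _ => ?_)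
  refine mem_closure_of_tendsto (lp.hasSum_single hp f)
    (Eventually.of_forall fun t => Submodule.sum_mem _ fun i _ => ?_)
  exact Submodule.subset_span (Set.mem_iUnion.2 ⟨i, f i, rfl⟩)

end SummablePowers

section FormalOperators

variable {ι : Type*}

section Ladder

variable [DecidableEq ι]

/-- The annihilation operator `a_k` on arbitrary coefficient families. -/
noncomputable def annihilateCoeff (k : ι) : ((ι → ℕ) → ℂ) →L[ℂ] ((ι → ℕ) → ℂ) :=
  .pi fun n => (√(n k + 1) : ℂ) • .proj (n + Pi.single k 1)

/-- The creation operator `a_k^*` on arbitrary coefficient families. -/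
noncomputable def createCoeff (k : ι) : ((ι → ℕ) → ℂ) →L[ℂ] ((ι → ℕ) → ℂ) :=
  .pi fun n => (√(n k) : ℂ) • .proj (n - Pi.single k 1)

theorem annihilateCoeff_apply (k : ι) (f : (ι → ℕ) → ℂ) (n : ι → ℕ) :
    annihilateCoeff k f n = (√(n k + 1) : ℂ) * f (n + Pi.single k 1) := rfl

theorem createCoeff_apply (k : ι) (f : (ι → ℕ) → ℂ) (n : ι → ℕ) :
    createCoeff k f n = (√(n k) : ℂ) * f (n - Pi.single k 1) := rfl

theorem eq_zero_or_eq_add_single (k : ι) (n : ι → ℕ) :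
    n k = 0 ∨ ∃ m : ι → ℕ, n = m + Pi.single k 1 := by
  refine or_iff_not_imp_left.2 fun h => ⟨n - Pi.single k 1, (tsub_add_cancel_of_le ?_).symm⟩
  exact update_le_iff.2 ⟨Nat.one_le_iff_ne_zero.2 h, fun _ _ => Nat.zero_le _⟩

theorem createCoeff_apply_of_eq_zero {k : ι} {n : ι → ℕ} (h : n k = 0) (f : (ι → ℕ) → ℂ) :
    createCoeff k f n = 0 := by
  simp [createCoeff_apply, h]

theorem createCoeff_apply_add_single (k : ι) (f : (ι → ℕ) → ℂ) (n : ι → ℕ) :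
    createCoeff k f (n + Pi.single k 1) = (√(n k + 1) : ℂ) * f n := by
  simp [createCoeff_apply]

end Ladder

variable [Fintype ι]

/-- The function `g` of the particle number, as a multiplication operator on coefficient
families. -/
def numberMul (g : ℝ → ℝ) (f : (ι → ℕ) → ℂ) (n : ι → ℕ) : ℂ :=
  (g (∑ i, (n i : ℝ)) : ℂ) * f n

theorem numberMul_numberMul (g h : ℝ → ℝ) (f : (ι → ℕ) → ℂ) :
    numberMul g (numberMul h f) = numberMul (fun x => g x * h x) f := by
  ext n
  simp [numberMul, mul_assoc]

theorem numberMul_congr {g h : ℝ → ℝ} (hgh : ∀ x, 0 ≤ x → g x = h x) (f : (ι → ℕ) → ℂ) :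
    numberMul g f = numberMul h f := by
  ext n
  rw [numberMul, hgh _ (by positivity), numberMul]

theorem norm_numberMul (g : ℝ → ℝ) (f : (ι → ℕ) → ℂ) (n : ι → ℕ) :
    ‖numberMul g f n‖ = |g (∑ i, (n i : ℝ))| * ‖f n‖ := by
  rw [numberMul, norm_mul, Complex.norm_real, Real.norm_eq_abs]

theorem numberMul_one (f : (ι → ℕ) → ℂ) : numberMul (fun _ => 1) f = f := by
  ext n
  simp [numberMul]

theorem natCast_le_sum (n : ι → ℕ) (k : ι) : (n k : ℝ) ≤ ∑ i, (n i : ℝ) :=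
  Finset.single_le_sum (fun i _ => Nat.cast_nonneg (n i)) (Finset.mem_univ k)

/-- The coefficient families in the form domain of the power `N ^ s` of the particle number, that
is, with `(N + 1) ^ (s / 2) f` square-summable. -/
def HasMoment (s : ℕ) (f : (ι → ℕ) → ℂ) : Prop :=
  Memℓp (numberMul (fun x => √(x + 1) ^ s) f) 2

theorem hasMoment_zero_iff {f : (ι → ℕ) → ℂ} : HasMoment 0 f ↔ Memℓp f 2 := by
  simp [HasMoment, numberMul_one]

/-- `T` changes the particle number by `-d` and is bounded relative to `(N + 1) ^ (s / 2)`, on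
every scale of moments. -/
structure IsGraded (d : ℝ) (s : ℕ) (T : ((ι → ℕ) → ℂ) →L[ℂ] ((ι → ℕ) → ℂ)) : Prop where
  map_numberMul : ∀ g f, T (numberMul g f) = numberMul (fun x => g (x + d)) (T f)
  hasMoment : ∀ ⦃p f⦄, HasMoment (p + s) f → HasMoment p (T f)

theorem IsGraded.mul {d d' : ℝ} {s s' : ℕ} {S T : ((ι → ℕ) → ℂ) →L[ℂ] ((ι → ℕ) → ℂ)}
    (hS : IsGraded d s S) (hT : IsGraded d' s' T) : IsGraded (d + d') (s + s') (S * T) where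
  map_numberMul g f := by
    change S (T (numberMul g f)) = numberMul _ (S (T f))
    simp only [hT.map_numberMul, hS.map_numberMul, add_assoc]
  hasMoment p f hf := hS.hasMoment (hT.hasMoment (by rwa [add_assoc]))

variable [DecidableEq ι]

theorem sum_add_single (n : ι → ℕ) (k : ι) :
    ∑ i, ((n + Pi.single k 1 : ι → ℕ) i : ℝ) = ∑ i, (n i : ℝ) + 1 := by
  exact_mod_cast (Finset.sum_add_distrib.trans (by simp) :
    ∑ i, (n + Pi.single k 1 : ι → ℕ) i = ∑ i, n i + 1)

theorem annihilateCoeff_numberMul (k : ι) (g : ℝ → ℝ) (f : (ι → ℕ) → ℂ) :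
    annihilateCoeff k (numberMul g f) = numberMul (fun x => g (x + 1)) (annihilateCoeff k f) := by
  ext n
  simp only [annihilateCoeff_apply, numberMul, sum_add_single]
  ring

theorem createCoeff_numberMul (k : ι) (g : ℝ → ℝ) (f : (ι → ℕ) → ℂ) :
    createCoeff k (numberMul g f) = numberMul (fun x => g (x + -1)) (createCoeff k f) := by
  ext n
  rcases eq_zero_or_eq_add_single k n with h | ⟨m, rfl⟩
  · simp only [numberMul, createCoeff_apply_of_eq_zero h, mul_zero]
  · simp only [numberMul, createCoeff_apply_add_single, sum_add_single, add_neg_cancel_right]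
    ring

theorem HasMoment.annihilateCoeff {s : ℕ} {f : (ι → ℕ) → ℂ} (hf : HasMoment (s + 1) f) (k : ι) :
    HasMoment s (annihilateCoeff k f) := by
  refine (memℓp_norm_iff.2 (memℓp_comp (by norm_num) (add_left_injective (Pi.single k 1)) hf)).mono
    fun n => ?_
  rw [Function.comp_apply, norm_numberMul, norm_numberMul, annihilateCoeff_apply, norm_mul,
    Complex.norm_real, Real.norm_of_nonneg (by positivity), abs_of_nonneg (by positivity),
    abs_of_nonneg (by positivity), sum_add_single, pow_succ, ← mul_assoc]
  have hk := natCast_le_sum n k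
  gcongr <;> linarith

theorem HasMoment.createCoeff {s : ℕ} {f : (ι → ℕ) → ℂ} (hf : HasMoment (s + 1) f) (k : ι) :
    HasMoment s (createCoeff k f) := by
  refine memℓp_of_comp (by norm_num) (add_left_injective (Pi.single k 1)) (fun n hn => ?_) ?_
  · have h := (eq_zero_or_eq_add_single k n).resolve_right fun ⟨m, hm⟩ => hn ⟨m, hm.symm⟩
    rw [numberMul, createCoeff_apply_of_eq_zero h, mul_zero]
  refine ((memℓp_norm_iff.2 hf).const_smul (2 ^ s : ℝ)).mono fun n => ?_
  have hsqrt : √(∑ i, (n i : ℝ) + 1 + 1) ≤ 2 * √(∑ i, (n i : ℝ) + 1) := by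
    have hn : 0 ≤ ∑ i, (n i : ℝ) := by positivity
    refine Real.sqrt_le_iff.2 ⟨by positivity, ?_⟩
    rw [mul_pow, Real.sq_sqrt (by positivity)]
    linarith
  rw [Function.comp_apply, norm_numberMul, createCoeff_apply_add_single, norm_mul,
    Complex.norm_real, Real.norm_of_nonneg (by positivity), abs_of_nonneg (by positivity),
    sum_add_single, Pi.smul_apply, norm_numberMul, abs_of_nonneg (by positivity), smul_eq_mul,
    pow_succ]
  calc √(∑ i, (n i : ℝ) + 1 + 1) ^ s * (√(n k + 1) * ‖f n‖)
      ≤ (2 * √(∑ i, (n i : ℝ) + 1)) ^ s * (√(∑ i, (n i : ℝ) + 1) * ‖f n‖) := by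
        gcongr
        exact natCast_le_sum n k
    _ = 2 ^ s * (√(∑ i, (n i : ℝ) + 1) ^ s * √(∑ i, (n i : ℝ) + 1) * ‖f n‖) := by ring

theorem isGraded_annihilateCoeff (k : ι) : IsGraded 1 1 (annihilateCoeff k) :=
  ⟨annihilateCoeff_numberMul k, fun _ _ hf => hf.annihilateCoeff k⟩

theorem isGraded_createCoeff (k : ι) : IsGraded (-1) 1 (createCoeff k) :=
  ⟨createCoeff_numberMul k, fun _ _ hf => hf.createCoeff k⟩

end FormalOperators

section Cutoffs

/-- The piecewise linear cutoff that equals `1` at `0` and vanishes beyond `K + 1`. -/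
noncomputable def cutoff (K : ℕ) (x : ℝ) : ℝ := max 0 (1 - x / (K + 1))

theorem cutoff_nonneg (K : ℕ) (x : ℝ) : 0 ≤ cutoff K x := le_max_left _ _

theorem cutoff_eq_zero {K : ℕ} {x : ℝ} (h : K + 1 ≤ x) : cutoff K x = 0 :=
  max_eq_left (sub_nonpos.2 ((one_le_div₀ (by positivity)).2 h))

theorem abs_cutoff_sub_one_le (K : ℕ) {x : ℝ} (hx : 0 ≤ x) : |cutoff K x - 1| ≤ 1 := by
  have hle : cutoff K x ≤ 1 := max_le zero_le_one (sub_le_self _ (by positivity))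
  exact abs_le.2 ⟨by linarith [cutoff_nonneg K x], by linarith⟩

theorem tendsto_cutoff (x : ℝ) : Tendsto (fun K => cutoff K x) atTop (𝓝 1) := by
  have h : Tendsto (fun K : ℕ => 1 - x / (K + 1)) atTop (𝓝 (1 - 0)) :=
    tendsto_const_nhds.sub (tendsto_const_nhds.div_atTop
      (tendsto_atTop_add_const_right _ _ tendsto_natCast_atTop_atTop))
  simpa [cutoff] using (tendsto_const_nhds (x := (0 : ℝ))).max h

theorem abs_cutoff_sub_cutoff_le (K : ℕ) (x y : ℝ) :
    |cutoff K x - cutoff K y| ≤ |x - y| / (K + 1) := by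
  have h := abs_max_sub_max_le_abs (1 - x / (K + 1)) (1 - y / (K + 1)) 0
  rw [max_comm, max_comm _ (0 : ℝ)] at h
  refine h.trans_eq ?_
  rw [sub_sub_sub_cancel_left, ← sub_div, abs_div, abs_sub_comm,
    abs_of_pos (by positivity : (0 : ℝ) < K + 1)]

theorem abs_cutoff_add_sub_cutoff_mul_le (K : ℕ) {x : ℝ} (hx : 0 ≤ x) (d : ℝ) :
    |cutoff K (x + d) - cutoff K x| * |x + d + 1| ≤ |d| * (|d| + 2) := by
  have hd := neg_abs_le d
  have hd' := le_abs_self d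
  have hK : (1 : ℝ) ≤ K + 1 := by simp
  by_cases hfar : K + 1 ≤ x ∧ K + 1 ≤ x + d
  · rw [cutoff_eq_zero hfar.1, cutoff_eq_zero hfar.2, sub_zero, abs_zero, zero_mul]
    positivity
  have hnear : |x + d + 1| ≤ (K + 1) * (|d| + 2) := by
    have hlt : x + d < K + 1 + |d| := by
      rcases not_and_or.1 hfar with h | h <;> linarith
    have : |d| ≤ (K + 1) * |d| := le_mul_of_one_le_left (abs_nonneg d) hK
    exact abs_le.2 ⟨by nlinarith, by nlinarith⟩
  calc |cutoff K (x + d) - cutoff K x| * |x + d + 1|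
      ≤ |x + d - x| / (K + 1) * ((K + 1) * (|d| + 2)) := by
        gcongr
        exact abs_cutoff_sub_cutoff_le K _ _
    _ = |d| * (|d| + 2) := by
        rw [add_sub_cancel_left]
        field_simp

variable {ι : Type*} [Fintype ι]

theorem finite_setOf_numberMul_cutoff_ne_zero (K : ℕ) (f : (ι → ℕ) → ℂ) :
    {n | numberMul (cutoff K) f n ≠ 0}.Finite := by
  refine (Set.Finite.pi' fun _ : ι => Set.finite_Iic K).subset fun n hn i => ?_
  contrapose! hn
  rw [Set.mem_Iic, not_le] at hn
  have hK : (K : ℝ) + 1 ≤ ∑ i, (n i : ℝ) := by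
    refine le_trans ?_ (natCast_le_sum n i)
    exact_mod_cast hn
  simp [numberMul, cutoff_eq_zero hK]

variable (ι) in
/-- The operators whose commutators with the particle number cutoffs are dominated in `ℓ²`,
uniformly in the cutoff. Such operators agree with the closure of their restriction to the vectors
with boundedly many particles, see `mem_topologicalClosure_graph_onFock`. -/
def cutoffTame : Submodule ℂ (((ι → ℕ) → ℂ) →L[ℂ] ((ι → ℕ) → ℂ)) where
  carrier := {T | ∀ f, Memℓp f 2 → ∃ g : (ι → ℕ) → ℝ, Memℓp g 2 ∧
    ∀ K n, ‖T (numberMul (cutoff K) f) n - numberMul (cutoff K) (T f) n‖ ≤ g n}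
  zero_mem' f _ := ⟨0, zero_memℓp, fun K n => by simp [numberMul]⟩
  add_mem' {S T} hS hT f hf := by
    obtain ⟨g, hg, hSg⟩ := hS f hf
    obtain ⟨h, hh, hTh⟩ := hT f hf
    refine ⟨g + h, hg.add hh, fun K n => ?_⟩
    refine le_of_eq_of_le (congrArg norm ?_) (norm_add_le_of_le (hSg K n) (hTh K n))
    simp only [numberMul, add_apply, Pi.add_apply]
    ring
  smul_mem' c T hT f hf := by
    obtain ⟨g, hg, hTg⟩ := hT f hf
    refine ⟨‖c‖ • g, hg.const_smul ‖c‖, fun K n => ?_⟩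
    rw [Pi.smul_apply, smul_eq_mul]
    refine le_of_eq_of_le ?_ (mul_le_mul_of_nonneg_left (hTg K n) (norm_nonneg c))
    rw [← norm_mul]
    congr 1
    simp only [numberMul, smul_apply, Pi.smul_apply, smul_eq_mul]
    ring

theorem one_mem_cutoffTame : 1 ∈ cutoffTame ι :=
  fun f _ => ⟨0, zero_memℓp, fun K n => by simp⟩

theorem IsGraded.mem_cutoffTame {d : ℝ} {T : ((ι → ℕ) → ℂ) →L[ℂ] ((ι → ℕ) → ℂ)}
    (hT : IsGraded d 2 T) : T ∈ cutoffTame ι := by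
  intro f hf
  obtain ⟨h, rfl⟩ : ∃ h, numberMul (fun x => x + 1) h = f := by
    refine ⟨numberMul (fun x => (x + 1)⁻¹) f, ?_⟩
    rw [numberMul_numberMul, numberMul_congr (h := fun _ => 1) fun x hx => ?_, numberMul_one]
    exact mul_inv_cancel₀ (by positivity)
  have hh : HasMoment 2 h := by
    rwa [HasMoment, numberMul_congr fun x hx => Real.sq_sqrt (by positivity)]
  refine ⟨fun n => |d| * (|d| + 2) * ‖T h n‖, ?_, fun K n => ?_⟩
  · exact (memℓp_norm_iff.2 (hasMoment_zero_iff.1 (hT.hasMoment hh))).const_mul _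
  have hcomm : T (numberMul (cutoff K) (numberMul (fun x => x + 1) h)) n -
      numberMul (cutoff K) (T (numberMul (fun x => x + 1) h)) n = numberMul
      (fun x => (cutoff K (x + d) - cutoff K x) * (x + d + 1)) (T h) n := by
    rw [numberMul_numberMul, hT.map_numberMul, hT.map_numberMul, numberMul_numberMul]
    simp only [numberMul]
    push_cast
    ring
  rw [hcomm, norm_numberMul, abs_mul]
  exact mul_le_mul_of_nonneg_right (abs_cutoff_add_sub_cutoff_mul_le K (by positivity) d)
    (norm_nonneg _)

end Cutoffs

section CanonicalCommutationRelations

variable {ι : Type*} [DecidableEq ι]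

theorem commute_annihilateCoeff (k l : ι) : Commute (annihilateCoeff k) (annihilateCoeff l) := by
  ext f n
  rcases eq_or_ne k l with rfl | h
  · rfl
  simp only [mul_apply_eq_comp, annihilateCoeff_apply, Pi.add_apply,
    Pi.single_eq_of_ne h, Pi.single_eq_of_ne h.symm, add_zero,
    add_right_comm n (Pi.single l 1) (Pi.single k 1)]
  ring

theorem commute_createCoeff (k l : ι) : Commute (createCoeff k) (createCoeff l) := by
  ext f n
  rcases eq_or_ne k l with rfl | h
  · rfl
  simp only [mul_apply_eq_comp, createCoeff_apply, Pi.sub_apply,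
    Pi.single_eq_of_ne h, Pi.single_eq_of_ne h.symm, tsub_zero,
    tsub_right_comm (a := n) (b := Pi.single l 1) (c := Pi.single k 1)]
  ring

theorem annihilateCoeff_createCoeff_self (k : ι) (f : (ι → ℕ) → ℂ) (n : ι → ℕ) :
    annihilateCoeff k (createCoeff k f) n = (n k + 1) * f n := by
  rw [annihilateCoeff_apply, createCoeff_apply_add_single, ← mul_assoc, ← Complex.ofReal_mul,
    Real.mul_self_sqrt (by positivity)]
  push_cast
  rfl

theorem createCoeff_annihilateCoeff_self (k : ι) (f : (ι → ℕ) → ℂ) (n : ι → ℕ) :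
    createCoeff k (annihilateCoeff k f) n = n k * f n := by
  rcases eq_zero_or_eq_add_single k n with h | ⟨m, rfl⟩
  · simp [createCoeff_apply_of_eq_zero h, h]
  · rw [createCoeff_apply_add_single, annihilateCoeff_apply, ← mul_assoc, ← Complex.ofReal_mul,
      Real.mul_self_sqrt (by positivity)]
    simp

theorem lie_annihilateCoeff_createCoeff_self (k : ι) : ⁅annihilateCoeff k, createCoeff k⁆ = 1 := by
  ext f n
  simp only [Ring.lie_def, sub_apply, mul_apply_eq_comp,
    Pi.sub_apply, annihilateCoeff_createCoeff_self, createCoeff_annihilateCoeff_self,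
    one_apply_eq_self]
  ring

theorem commute_annihilateCoeff_createCoeff {k l : ι} (h : k ≠ l) :
    Commute (annihilateCoeff k) (createCoeff l) := by
  ext f n
  change annihilateCoeff k (createCoeff l f) n = createCoeff l (annihilateCoeff k f) n
  rw [annihilateCoeff_apply]
  rcases eq_zero_or_eq_add_single l n with hn | ⟨m, rfl⟩
  · rw [createCoeff_apply_of_eq_zero hn, createCoeff_apply_of_eq_zero (by simp [hn, h.symm]),
      mul_zero]
  · rw [add_right_comm, createCoeff_apply_add_single, createCoeff_apply_add_single,
      annihilateCoeff_apply]
    simp only [Pi.add_apply, Pi.single_eq_of_ne h, Pi.single_eq_of_ne h.symm, add_zero]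
    ring

end CanonicalCommutationRelations

section FockSpace

variable {ι : Type*}

theorem single_mem_finiteParticle [DecidableEq (ι → ℕ)] (n : ι → ℕ) (z : ℂ) :
    (lp.single 2 n z : BosonFock ι) ∈ finiteParticle ι :=
  (Set.finite_singleton n).subset fun m hm => by
    by_contra h
    exact hm (lp.single_apply_ne _ _ _ h)

theorem dense_finiteParticle : Dense (finiteParticle ι : Set (BosonFock ι)) := by
  classical
  intro ψ
  refine mem_closure_of_tendsto (lp.hasSum_single (by norm_num) ψ)
    (Eventually.of_forall fun s => Submodule.sum_mem _ fun n _ => single_mem_finiteParticle n _)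

/-- The operator `a` on the vectors with boundedly many particles acts on coefficients as `T`. -/
def ActsBy (a : Module.End ℂ (finiteParticle ι)) (T : ((ι → ℕ) → ℂ) →L[ℂ] ((ι → ℕ) → ℂ)) : Prop :=
  ∀ ψ : finiteParticle ι, ((a ψ : BosonFock ι) : (ι → ℕ) → ℂ) = T (ψ : BosonFock ι)

section ActsBy

variable {a b : Module.End ℂ (finiteParticle ι)} {S T : ((ι → ℕ) → ℂ) →L[ℂ] ((ι → ℕ) → ℂ)}

theorem ActsBy.eq (ha : ActsBy a T) (hb : ActsBy b T) : a = b :=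
  LinearMap.ext fun ψ => Subtype.ext (lp.ext ((ha ψ).trans (hb ψ).symm))

theorem ActsBy.one : ActsBy (1 : Module.End ℂ (finiteParticle ι)) 1 := fun _ => rfl

theorem ActsBy.mul (ha : ActsBy a S) (hb : ActsBy b T) : ActsBy (a * b) (S * T) :=
  fun ψ => (ha (b ψ)).trans (congrArg S (hb ψ))

theorem ActsBy.add (ha : ActsBy a S) (hb : ActsBy b T) : ActsBy (a + b) (S + T) :=
  fun ψ => congrArg₂ (· + ·) (ha ψ) (hb ψ)

theorem ActsBy.sub (ha : ActsBy a S) (hb : ActsBy b T) : ActsBy (a - b) (S - T) :=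
  fun ψ => congrArg₂ (· - ·) (ha ψ) (hb ψ)

theorem ActsBy.lie (ha : ActsBy a S) (hb : ActsBy b T) : ActsBy ⁅a, b⁆ ⁅S, T⁆ :=
  (ha.mul hb).sub (hb.mul ha)

theorem ActsBy.smul (c : ℂ) (ha : ActsBy a T) : ActsBy (c • a) (c • T) :=
  fun ψ => congrArg (c • ·) (ha ψ)

theorem ActsBy.sum {κ : Type*} {s : Finset κ} {a : κ → Module.End ℂ (finiteParticle ι)}
    {T : κ → ((ι → ℕ) → ℂ) →L[ℂ] ((ι → ℕ) → ℂ)} (h : ∀ i, ActsBy (a i) (T i)) :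
    ActsBy (∑ i ∈ s, a i) (∑ i ∈ s, T i) := by
  classical
  induction s using Finset.induction_on with
  | empty => exact fun _ => rfl
  | insert i s hi ih =>
    rw [Finset.sum_insert hi, Finset.sum_insert hi]
    exact (h i).add ih

end ActsBy

theorem mem_graph_onFock (a : Module.End ℂ (finiteParticle ι)) (ψ : finiteParticle ι) :
    ((ψ : BosonFock ι), (a ψ : BosonFock ι)) ∈ (onFock a).graph :=
  LinearPMap.mem_graph (onFock a) ψ

variable {a : Module.End ℂ (finiteParticle ι)} {T : ((ι → ℕ) → ℂ) →L[ℂ] ((ι → ℕ) → ℂ)}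

theorem eq_of_mem_topologicalClosure_graph_onFock (ha : ActsBy a T) {φ ψ : BosonFock ι}
    (h : (φ, ψ) ∈ (onFock a).graph.topologicalClosure) : (ψ : (ι → ℕ) → ℂ) = T φ := by
  have hcoe : Continuous fun χ : BosonFock ι => (χ : (ι → ℕ) → ℂ) :=
    (lp.uniformContinuous_coe (E := fun _ : ι → ℕ => ℂ) (p := 2)).continuous
  have hclosed : IsClosed {x : BosonFock ι × BosonFock ι | (x.2 : (ι → ℕ) → ℂ) = T x.1} :=
    isClosed_eq (hcoe.comp continuous_snd) (T.continuous.comp (hcoe.comp continuous_fst))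
  refine closure_minimal (fun x hx => ?_) hclosed h
  obtain ⟨χ, h₁, h₂⟩ := (LinearPMap.mem_graph_iff _).1 hx
  change (x.2 : (ι → ℕ) → ℂ) = T x.1
  rw [← h₁, ← h₂]
  exact ha χ

theorem inner_apply_single [DecidableEq (ι → ℕ)] (ha : ActsBy a T) (hsymm : a.IsSymmetric)
    (n : ι → ℕ) (φ : BosonFock ι) :
    inner ℂ (a ⟨lp.single 2 n 1, single_mem_finiteParticle n 1⟩ : BosonFock ι) φ = T φ n := by
  set e : finiteParticle ι := ⟨lp.single 2 n 1, single_mem_finiteParticle n 1⟩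
  have hl : Continuous fun χ : BosonFock ι => inner ℂ (a e : BosonFock ι) χ := by fun_prop
  have hr : Continuous fun χ : BosonFock ι => T χ n :=
    (continuous_apply n).comp (T.continuous.comp
      (lp.uniformContinuous_coe (E := fun _ : ι → ℕ => ℂ) (p := 2)).continuous)
  refine congrFun (hl.ext_on dense_finiteParticle hr fun χ hχ => ?_) φ
  calc inner ℂ (a e : BosonFock ι) χ
      = inner ℂ (e : BosonFock ι) (a ⟨χ, hχ⟩ : BosonFock ι) := hsymm e ⟨χ, hχ⟩
    _ = T χ n := by
      rw [lp.inner_single_left, ha]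
      simp

theorem coe_eq_of_mem_graph_adjoint_onFock (ha : ActsBy a T) (hsymm : a.IsSymmetric)
    {φ ψ : BosonFock ι} (h : (φ, ψ) ∈ (onFock a).adjoint.graph) : (ψ : (ι → ℕ) → ℂ) = T φ := by
  classical
  rw [LinearPMap.adjoint_graph_eq_graph_adjoint dense_finiteParticle,
    Submodule.mem_adjoint_iff] at h
  ext n
  have hn := sub_eq_zero.1 (h _ _ (mem_graph_onFock a ⟨_, single_mem_finiteParticle n 1⟩))
  rw [inner_apply_single ha hsymm, lp.inner_single_left] at hn
  simpa using hn.symm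

variable [Fintype ι]

theorem mem_topologicalClosure_graph_onFock (ha : ActsBy a T) (hT : T ∈ cutoffTame ι)
    {φ ψ : BosonFock ι} (h : (ψ : (ι → ℕ) → ℂ) = T φ) :
    (φ, ψ) ∈ (onFock a).graph.topologicalClosure := by
  have hfin (K : ℕ) := finite_setOf_numberMul_cutoff_ne_zero K (φ : (ι → ℕ) → ℂ)
  let φK (K : ℕ) : finiteParticle ι :=
    ⟨⟨numberMul (cutoff K) φ, (memℓp_zero (hfin K)).of_exponent_ge zero_le⟩, hfin K⟩
  have hpoint (f : (ι → ℕ) → ℂ) (n : ι → ℕ) :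
      Tendsto (fun K => numberMul (cutoff K) f n) atTop (𝓝 (f n)) := by
    simpa [numberMul] using
      ((Complex.continuous_ofReal.tendsto 1).comp (tendsto_cutoff _)).mul_const (f n)
  have hdom (f : (ι → ℕ) → ℂ) (K : ℕ) (n : ι → ℕ) : ‖numberMul (cutoff K) f n - f n‖ ≤ ‖f n‖ := by
    have heq : numberMul (cutoff K) f n - f n = numberMul (fun x => cutoff K x - 1) f n := by
      simp only [numberMul]
      push_cast
      ring
    rw [heq, norm_numberMul]
    exact mul_le_of_le_one_left (norm_nonneg _) (abs_cutoff_sub_one_le K (by positivity))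
  have hφ : Tendsto (fun K => (φK K : BosonFock ι)) atTop (𝓝 φ) :=
    tendsto_lp_of_dominated (by norm_num) (memℓp_norm_iff.2 (lp.memℓp φ)) (hdom φ) (hpoint φ)
  have hψ : Tendsto (fun K => (a (φK K) : BosonFock ι)) atTop (𝓝 ψ) := by
    obtain ⟨g, hg, hTg⟩ := hT φ (lp.memℓp φ)
    refine tendsto_lp_of_dominated (by norm_num) (hg.add (memℓp_norm_iff.2 (lp.memℓp ψ)))
      (fun K n => ?_) fun n => ?_
    · rw [ha, h]
      exact (norm_sub_le_norm_sub_add_norm_sub _ _ _).trans (add_le_add (hTg K n) (hdom _ K n))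
    · rw [h, funext fun K => congrFun (ha (φK K)) n]
      exact ((continuous_apply n).tendsto _).comp ((T.continuous.tendsto _).comp
        (tendsto_pi_nhds.2 (hpoint φ)))
  exact mem_closure_of_tendsto (hφ.prodMk_nhds hψ)
    (Eventually.of_forall fun K => mem_graph_onFock a (φK K))

theorem isSelfAdjoint_closure_onFock (ha : ActsBy a T) (hsymm : a.IsSymmetric)
    (hT : T ∈ cutoffTame ι) : IsSelfAdjoint (onFock a).closure :=
  isSelfAdjoint_closure_of_graph_adjoint_le dense_finiteParticle hsymm fun _ h =>
    mem_topologicalClosure_graph_onFock ha hT (coe_eq_of_mem_graph_adjoint_onFock ha hsymm h)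

theorem mem_topologicalClosure_graph_onFock_iff (ha : ActsBy a T) (hT : T ∈ cutoffTame ι)
    {φ ψ : BosonFock ι} :
    (φ, ψ) ∈ (onFock a).graph.topologicalClosure ↔ (ψ : (ι → ℕ) → ℂ) = T φ :=
  ⟨eq_of_mem_topologicalClosure_graph_onFock ha, mem_topologicalClosure_graph_onFock ha hT⟩

theorem mem_graph_closure_onFock (ha : ActsBy a T) (hsymm : a.IsSymmetric) (hT : T ∈ cutoffTame ι)
    {φ ψ : BosonFock ι} : (φ, ψ) ∈ (onFock a).closure.graph ↔ (ψ : (ι → ℕ) → ℂ) = T φ := by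
  have hclosable : (onFock a).IsClosable :=
    isClosable_of_isFormalAdjoint_self dense_finiteParticle hsymm
  rw [← hclosable.graph_closure_eq_closure_graph, mem_topologicalClosure_graph_onFock_iff ha hT]

end FockSpace

section QuadraticOperators

variable {ι : Type*} [DecidableEq ι]

theorem actsBy_annihilate (k : ι) : ActsBy (annihilate k) (annihilateCoeff k) := fun _ => rfl

theorem actsBy_create (k : ι) : ActsBy (create k) (createCoeff k) := fun _ => rfl

theorem inner_create_left (k : ι) (ψ χ : finiteParticle ι) :
    inner ℂ (create k ψ) χ = inner ℂ ψ (annihilate k χ) := by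
  have hinj : Function.Injective fun n : ι → ℕ => n + Pi.single k 1 := add_left_injective _
  change inner ℂ (create k ψ : BosonFock ι) (χ : BosonFock ι) =
    inner ℂ (ψ : BosonFock ι) (annihilate k χ : BosonFock ι)
  rw [lp.inner_eq_tsum, lp.inner_eq_tsum, actsBy_create, actsBy_annihilate,
    ← hinj.tsum_eq (f := fun n => inner ℂ (createCoeff k ψ n) ((χ : BosonFock ι) n))
      fun n hn => ?_]
  · refine tsum_congr fun n => ?_
    rw [createCoeff_apply_add_single, annihilateCoeff_apply]
    simp only [RCLike.inner_apply, map_mul, Complex.conj_ofReal]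
    ring
  · refine ((eq_zero_or_eq_add_single k n).resolve_left fun h => hn ?_).imp fun _ => Eq.symm
    dsimp only
    rw [createCoeff_apply_of_eq_zero h, inner_zero_left]

theorem inner_annihilate_left (k : ι) (ψ χ : finiteParticle ι) :
    inner ℂ (annihilate k ψ) χ = inner ℂ ψ (create k χ) := by
  rw [← inner_conj_symm (annihilate k ψ) χ, ← inner_create_left]
  exact inner_conj_symm ψ (create k χ)

variable [Fintype ι]

/-- The quadratic expression `∑ₖₗ Ωₖₗ yₖ xₗ + Bₖₗ yₖ yₗ + conj(Bₖₗ) xₖ xₗ + c` in an algebra, where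
`x` and `y` stand for the annihilation and the creation operators. It is evaluated both in the
operators on `finiteParticle` and in their extensions to arbitrary coefficient families. -/
noncomputable def quadraticExpr {R : Type*} [Ring R] [Algebra ℂ R] (x y : ι → R)
    (Ω B : Matrix ι ι ℂ) (c : ℝ) : R :=
  (∑ k, ∑ l, (Ω k l • (y k * x l) + B k l • (y k * y l)
    + (starRingEnd ℂ (B k l)) • (x k * x l))) + (c : ℂ) • 1

theorem actsBy_quadraticExpr (Ω B : Matrix ι ι ℂ) (c : ℝ) :
    ActsBy (quadraticExpr annihilate create Ω B c)
      (quadraticExpr annihilateCoeff createCoeff Ω B c) := by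
  have ha (k : ι) := actsBy_annihilate k
  have hc (k : ι) := actsBy_create k
  exact .add (.sum fun k => .sum fun l => .add (.add (.smul _ ((hc k).mul (ha l)))
    (.smul _ ((hc k).mul (hc l)))) (.smul _ ((ha k).mul (ha l)))) (.smul _ .one)

theorem quadraticExpr_mem_cutoffTame (Ω B : Matrix ι ι ℂ) (c : ℝ) :
    quadraticExpr annihilateCoeff createCoeff Ω B c ∈ cutoffTame ι := by
  have ha (k : ι) := isGraded_annihilateCoeff k
  have hc (k : ι) := isGraded_createCoeff k
  refine add_mem (sum_mem fun k _ => sum_mem fun l _ => add_mem (add_mem ?_ ?_) ?_)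
    (Submodule.smul_mem _ _ one_mem_cutoffTame)
  · exact Submodule.smul_mem _ _ ((hc k).mul (ha l)).mem_cutoffTame
  · exact Submodule.smul_mem _ _ ((hc k).mul (hc l)).mem_cutoffTame
  · exact Submodule.smul_mem _ _ ((ha k).mul (ha l)).mem_cutoffTame

theorem isSymmetric_quadraticExpr {Ω : Matrix ι ι ℂ} (hΩ : Ω.IsHermitian) (B : Matrix ι ι ℂ)
    (c : ℝ) : (quadraticExpr annihilate create Ω B c).IsSymmetric := by
  intro ψ χ
  have ha (k l : ι) : annihilate k * annihilate l = annihilate l * annihilate k :=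
    ((actsBy_annihilate k).mul (actsBy_annihilate l)).eq
      (commute_annihilateCoeff k l ▸ (actsBy_annihilate l).mul (actsBy_annihilate k))
  have hc (k l : ι) : create k * create l = create l * create k :=
    ((actsBy_create k).mul (actsBy_create l)).eq
      (commute_createCoeff k l ▸ (actsBy_create l).mul (actsBy_create k))
  have hstar (k l : ι) : starRingEnd ℂ (Ω k l) = Ω l k := hΩ.apply l k
  simp only [quadraticExpr, LinearMap.add_apply, LinearMap.sum_apply, LinearMap.smul_apply,
    Module.End.mul_apply, Module.End.one_apply, inner_add_left, inner_add_right, sum_inner,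
    inner_sum, inner_smul_left, inner_smul_right, inner_create_left, inner_annihilate_left,
    Finset.sum_add_distrib, Complex.conj_ofReal, Complex.conj_conj, hstar]
  have hcc (k l : ι) : create k (create l χ) = create l (create k χ) :=
    LinearMap.congr_fun (hc k l) χ
  have haa (k l : ι) : annihilate k (annihilate l χ) = annihilate l (annihilate k χ) :=
    LinearMap.congr_fun (ha k l) χ
  rw [Finset.sum_comm (f := fun k l => Ω l k * _), add_right_comm (∑ k, ∑ l, Ω k l * _)]
  simp only [hcc, haa]

theorem isSelfAdjoint_closure_quadraticOp {Ω : Matrix ι ι ℂ} (hΩ : Ω.IsHermitian)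
    (B : Matrix ι ι ℂ) (c : ℝ) : IsSelfAdjoint (quadraticOp Ω B c).closure :=
  isSelfAdjoint_closure_onFock (actsBy_quadraticExpr Ω B c) (isSymmetric_quadraticExpr hΩ B c)
    (quadraticExpr_mem_cutoffTame Ω B c)

theorem mem_graph_closure_quadraticOp {Ω : Matrix ι ι ℂ} (hΩ : Ω.IsHermitian) {B : Matrix ι ι ℂ}
    {c : ℝ} {φ ψ : BosonFock ι} : (φ, ψ) ∈ (quadraticOp Ω B c).closure.graph ↔
      (ψ : (ι → ℕ) → ℂ) = quadraticExpr annihilateCoeff createCoeff Ω B c φ :=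
  mem_graph_closure_onFock (actsBy_quadraticExpr Ω B c) (isSymmetric_quadraticExpr hΩ B c)
    (quadraticExpr_mem_cutoffTame Ω B c)

theorem isUnbounded_closure_onFock {ι : Type*} [DecidableEq (ι → ℕ)]
    {a : Module.End ℂ (finiteParticle ι)} {T : ((ι → ℕ) → ℂ) →L[ℂ] ((ι → ℕ) → ℂ)} (ha : ActsBy a T)
    (h : ∀ C : ℝ, ∃ n m, C < ‖T (Pi.single n 1) m‖) : (onFock a).closure.IsUnbounded := by
  rintro ⟨C, hC⟩
  obtain ⟨n, m, hnm⟩ := h C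
  set e : finiteParticle ι := ⟨lp.single 2 n 1, single_mem_finiteParticle n 1⟩
  have he := hC ⟨e, (onFock a).le_closure.1 e.2⟩
  rw [← (onFock a).le_closure.2 (x := e) rfl] at he
  refine absurd he (not_le.2 ?_)
  calc C * ‖(e : BosonFock ι)‖ = C := by
        rw [lp.norm_single (by norm_num), norm_one, mul_one]
    _ < ‖(a e : BosonFock ι) m‖ := by
        rw [ha]
        exact hnm
    _ ≤ ‖(a e : BosonFock ι)‖ := lp.norm_apply_le_norm (by norm_num) _ m

end QuadraticOperators

section NumberOperator

variable {ι : Type*} [Fintype ι] [DecidableEq ι]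

variable (ι) in
/-- The particle number operator on arbitrary coefficient families. -/
noncomputable def numberCoeff : ((ι → ℕ) → ℂ) →L[ℂ] ((ι → ℕ) → ℂ) :=
  ∑ k, createCoeff k * annihilateCoeff k

theorem numberCoeff_apply (f : (ι → ℕ) → ℂ) : numberCoeff ι f = numberMul id f := by
  ext n
  simp only [numberCoeff, sum_apply, Finset.sum_apply, mul_apply_eq_comp,
    createCoeff_annihilateCoeff_self, numberMul, id_eq]
  rw [← Finset.sum_mul]
  push_cast
  rfl

theorem IsGraded.lie_numberCoeff {d : ℝ} {s : ℕ} {T : ((ι → ℕ) → ℂ) →L[ℂ] ((ι → ℕ) → ℂ)}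
    (hT : IsGraded d s T) : ⁅T, numberCoeff ι⁆ = (d : ℂ) • T := by
  ext f n
  simp only [Ring.lie_def, sub_apply, mul_apply_eq_comp, smul_apply, numberCoeff_apply,
    hT.map_numberMul, Pi.sub_apply, Pi.smul_apply, smul_eq_mul, numberMul, id_eq]
  push_cast
  ring

theorem actsBy_numberCoeff : ActsBy (∑ k, create k * annihilate k) (numberCoeff ι) :=
  .sum fun k => (actsBy_create k).mul (actsBy_annihilate k)

theorem isSymmetric_sum_create_mul_annihilate :
    (∑ k : ι, create k * annihilate k).IsSymmetric := fun ψ χ => by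
  simp only [LinearMap.sum_apply, Module.End.mul_apply, sum_inner, inner_sum, inner_create_left,
    inner_annihilate_left]

theorem numberCoeff_mem_cutoffTame : numberCoeff ι ∈ cutoffTame ι :=
  sum_mem fun k _ =>
    ((isGraded_createCoeff k).mul (isGraded_annihilateCoeff k)).mem_cutoffTame

theorem isSelfAdjoint_closure_numberOp : IsSelfAdjoint (numberOp ι).closure :=
  isSelfAdjoint_closure_onFock actsBy_numberCoeff isSymmetric_sum_create_mul_annihilate
    numberCoeff_mem_cutoffTame

theorem mem_graph_closure_numberOp {φ ψ : BosonFock ι} :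
    (φ, ψ) ∈ (numberOp ι).closure.graph ↔ (ψ : (ι → ℕ) → ℂ) = numberMul id φ := by
  rw [← numberCoeff_apply]
  exact mem_graph_closure_onFock actsBy_numberCoeff isSymmetric_sum_create_mul_annihilate
    numberCoeff_mem_cutoffTame

theorem isNonneg_closure_numberOp : (numberOp ι).closure.IsNonneg := by
  intro φ
  have hN := mem_graph_closure_numberOp.1 (LinearPMap.mem_graph _ φ)
  have hsum := lp.hasSum_inner (𝕜 := ℂ) (φ : BosonFock ι) ((numberOp ι).closure φ)
  refine (Complex.hasSum_re hsum).nonneg fun n => ?_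
  have hinner : inner ℂ ((φ : BosonFock ι) n) (numberMul id (φ : BosonFock ι) n) =
      (((∑ i, (n i : ℝ)) * ‖(φ : BosonFock ι) n‖ ^ 2 : ℝ) : ℂ) := by
    rw [numberMul, RCLike.inner_apply, mul_assoc, Complex.mul_conj', id_eq]
    push_cast
    rfl
  rw [hN, hinner, Complex.ofReal_re]
  positivity

theorem isUnbounded_closure_numberOp [Nonempty ι] : (numberOp ι).closure.IsUnbounded := by
  refine isUnbounded_closure_onFock actsBy_numberCoeff fun C => ?_
  obtain ⟨k⟩ := ‹Nonempty ι›
  obtain ⟨m, hm⟩ := exists_nat_gt C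
  refine ⟨Pi.single k m, Pi.single k m, ?_⟩
  rw [numberCoeff_apply, norm_numberMul, Pi.single_eq_same, norm_one, mul_one]
  have hsum : ∑ i, ((Pi.single k m : ι → ℕ) i : ℝ) = m := by
    exact_mod_cast Finset.sum_pi_single' k m Finset.univ |>.trans (if_pos (Finset.mem_univ k))
  rwa [hsum, id_eq, Nat.abs_cast]

theorem hasMoment_two_of_mem_domain_closure_numberOp {φ : BosonFock ι}
    (hφ : φ ∈ (numberOp ι).closure.domain) : HasMoment 2 (φ : (ι → ℕ) → ℂ) := by
  obtain ⟨ψ, hψ⟩ := LinearPMap.mem_domain_iff.1 hφ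
  have hadd : numberMul (fun x => √(x + 1) ^ 2) (φ : (ι → ℕ) → ℂ) = ψ + φ := by
    rw [numberMul_congr fun x hx => Real.sq_sqrt (by positivity), mem_graph_closure_numberOp.1 hψ]
    ext n
    simp only [numberMul, Pi.add_apply, id_eq]
    push_cast
    ring
  rw [HasMoment, hadd]
  exact (lp.memℓp ψ).add (lp.memℓp φ)

end NumberOperator

theorem lie_lie_smul_add_smul_of_su11 {R L : Type*} [CommRing R] [LieRing L] [LieAlgebra R L]
    {A B M : L} (hAB : ⁅A, B⁆ = M) (hAM : ⁅A, M⁆ = (2 : R) • A) (hBM : ⁅B, M⁆ = (-2 : R) • B)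
    (ω β : R) :
    ⁅ω • M + β • (A + B), ⁅ω • M + β • (A + B), M⁆⁆ =
      (-4 * β ^ 2) • M + (-4 * ω * β) • (A + B) := by
  have hMA : ⁅M, A⁆ = (-2 : R) • A := by rw [← lie_skew, hAM, neg_smul]
  have hMB : ⁅M, B⁆ = (2 : R) • B := by rw [← lie_skew, hBM, neg_smul, neg_neg]
  have hBA : ⁅B, A⁆ = -M := by rw [← lie_skew, hAB]
  have hM : ⁅ω • M + β • (A + B), M⁆ = (2 * β) • (A - B) := by
    simp only [add_lie, smul_lie, lie_self, hAM, hBM]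
    module
  rw [hM]
  simp only [lie_smul, lie_sub, add_lie, smul_lie, lie_self, hAB, hBA, hMA, hMB]
  module

theorem lie_annihilateCoeff_mul_createCoeff_mul {ι : Type*} [DecidableEq ι] {i j : ι} (h : i ≠ j) :
    ⁅annihilateCoeff i * annihilateCoeff j, createCoeff i * createCoeff j⁆ =
      createCoeff i * annihilateCoeff i + createCoeff j * annihilateCoeff j + 1 := by
  have hself (k : ι) : annihilateCoeff k * createCoeff k = createCoeff k * annihilateCoeff k + 1 :=
    sub_eq_iff_eq_add'.1 (lie_annihilateCoeff_createCoeff_self k)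
  rw [Ring.lie_def, (commute_annihilateCoeff_createCoeff h.symm).mul_mul_mul_comm,
    (commute_annihilateCoeff_createCoeff h).symm.mul_mul_mul_comm, hself, hself]
  noncomm_ring

section TwoModes

/-- The operator `a₀ a₁ + a₀^* a₁^*` on arbitrary coefficient families. -/
noncomputable def pairCoeff : ((Fin 2 → ℕ) → ℂ) →L[ℂ] ((Fin 2 → ℕ) → ℂ) :=
  annihilateCoeff 0 * annihilateCoeff 1 + createCoeff 0 * createCoeff 1

/-- The operator `ω (a₀^* a₀ + a₁^* a₁ + 1) + 2 β (a₀ a₁ + a₀^* a₁^*)` on arbitrary coefficient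
families. -/
noncomputable def twoModeCoeff (ω β : ℝ) : ((Fin 2 → ℕ) → ℂ) →L[ℂ] ((Fin 2 → ℕ) → ℂ) :=
  (ω : ℂ) • (numberCoeff (Fin 2) + 1) + (2 * β : ℂ) • pairCoeff

theorem lie_lie_twoModeCoeff (ω β : ℝ) :
    ⁅twoModeCoeff ω β, ⁅twoModeCoeff ω β, numberCoeff (Fin 2)⁆⁆ =
      twoModeCoeff (-16 * β ^ 2) (-4 * ω * β) := by
  let := LieRing.ofAssociativeRing (A := ((Fin 2 → ℕ) → ℂ) →L[ℂ] ((Fin 2 → ℕ) → ℂ))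
  have hone (T : ((Fin 2 → ℕ) → ℂ) →L[ℂ] ((Fin 2 → ℕ) → ℂ)) :
      ⁅T, numberCoeff (Fin 2) + 1⁆ = ⁅T, numberCoeff (Fin 2)⁆ := by
    rw [lie_add, (Commute.one_right T).lie_eq, add_zero]
  have hA := ((isGraded_annihilateCoeff (0 : Fin 2)).mul
    (isGraded_annihilateCoeff 1)).lie_numberCoeff
  have hB := ((isGraded_createCoeff (0 : Fin 2)).mul (isGraded_createCoeff 1)).lie_numberCoeff
  have hAB := lie_annihilateCoeff_mul_createCoeff_mul (by decide : (0 : Fin 2) ≠ 1)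
  rw [← Fin.sum_univ_two fun k => createCoeff k * annihilateCoeff k, ← numberCoeff] at hAB
  rw [show ((1 + 1 : ℝ) : ℂ) = 2 by norm_num] at hA
  rw [show ((-1 + -1 : ℝ) : ℂ) = -2 by norm_num] at hB
  have h := lie_lie_smul_add_smul_of_su11 hAB ((hone _).trans hA) ((hone _).trans hB)
    (ω : ℂ) (2 * β : ℂ)
  rw [hone] at h
  refine h.trans ?_
  rw [twoModeCoeff, pairCoeff]
  push_cast
  module

theorem quadraticExpr_fin_two {R : Type*} [Ring R] [Algebra ℂ R] {x y : Fin 2 → R}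
    (hx : Commute (x 0) (x 1)) (hy : Commute (y 0) (y 1)) (ω β : ℝ) :
    quadraticExpr x y !![(ω : ℂ), 0; 0, (ω : ℂ)] !![0, (β : ℂ); (β : ℂ), 0] ω =
      (ω : ℂ) • (∑ k, y k * x k + 1) + (2 * β : ℂ) • (x 0 * x 1 + y 0 * y 1) := by
  simp only [quadraticExpr, Fin.sum_univ_two, Matrix.of_apply, Matrix.cons_val_zero,
    Matrix.cons_val_one, Matrix.cons_val', Matrix.cons_val_fin_one, hx.eq, hy.eq, map_zero,
    Complex.conj_ofReal]
  module

theorem quadraticExpr_eq_twoModeCoeff (ω β : ℝ) :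
    quadraticExpr annihilateCoeff createCoeff !![(ω : ℂ), 0; 0, (ω : ℂ)]
      !![0, (β : ℂ); (β : ℂ), 0] ω = twoModeCoeff ω β :=
  quadraticExpr_fin_two (commute_annihilateCoeff 0 1) (commute_createCoeff 0 1) ω β

end TwoModes

section LocalFlow

variable {ι : Type*}

theorem graph_onFock_lie_lie_le (a b : Module.End ℂ (finiteParticle ι)) :
    (onFock ⁅b, ⁅b, a⁆⁆).graph ≤
      ((onFock b).closure.commOp ((onFock b).closure.commOp (onFock a).closure)).graph := by
  rintro ⟨φ, ψ⟩ h
  obtain ⟨χ, rfl, rfl⟩ := (LinearPMap.mem_graph_iff _).1 h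
  have hmem (c : Module.End ℂ (finiteParticle ι)) (χ : finiteParticle ι) :
      ((χ : BosonFock ι), (c χ : BosonFock ι)) ∈ (onFock c).closure.graph :=
    LinearPMap.le_graph_of_le (onFock c).le_closure (mem_graph_onFock c χ)
  exact mem_graph_commOp (hmem b) (mem_graph_commOp (hmem b) (hmem a)) χ

variable [Fintype ι] {x : Module.End ℂ (finiteParticle ι)}
  {y : ℝ → Module.End ℂ (finiteParticle ι)} {S : ((ι → ℕ) → ℂ) →L[ℂ] ((ι → ℕ) → ℂ)}
  {T : ℝ → ((ι → ℕ) → ℂ) →L[ℂ] ((ι → ℕ) → ℂ)}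

theorem isLocalFlow_closure_onFock (hx : ActsBy x S) (hy : ∀ t, ActsBy (y t) (T t))
    (hsymm : ∀ t, (y t).IsSymmetric) (hT : ∀ t, T t ∈ cutoffTame ι)
    (hTS : ∀ t, ⁅T t, ⁅T t, S⁆⁆ ∈ cutoffTame ι) {τ : ℝ} {D : Submodule ℂ (BosonFock ι)}
    (hD : finiteParticle ι ≤ D)
    (hflow : ∀ φ ∈ D, ∃ u v : ℝ → BosonFock ι, ∀ t ∈ Set.Ico 0 τ,
      (u t : (ι → ℕ) → ℂ) = T t φ ∧ (v t : (ι → ℕ) → ℂ) = ⁅T t, ⁅T t, S⁆⁆ φ ∧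
      HasDerivWithinAt u (v t) (Set.Ico 0 τ) t) :
    IsLocalFlow (onFock x).closure (fun t => (onFock (y t)).closure) τ (finiteParticle ι) D where
  core_le := hD
  core_X := LinearPMap.closureHasCore (onFock x)
  core_Y t _ := LinearPMap.closureHasCore (onFock (y t))
  flow_core φ hφ := by
    obtain ⟨u, v, huv⟩ := hflow φ (hD hφ)
    refine ⟨u, v, fun t ht => ?_⟩
    obtain ⟨hu, hv, hderiv⟩ := huv t ht
    refine ⟨(mem_graph_closure_onFock (hy t) (hsymm t) (hT t)).2 hu, ?_, hderiv⟩
    have hφv : ((⁅y t, ⁅y t, x⁆⁆ ⟨φ, hφ⟩ : finiteParticle ι) : BosonFock ι) = v t :=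
      lp.ext (((hy t).lie ((hy t).lie hx) ⟨φ, hφ⟩).trans hv.symm)
    exact hφv ▸ graph_onFock_lie_lie_le x (y t) (mem_graph_onFock _ ⟨φ, hφ⟩)
  flow_dom φ hφ := by
    obtain ⟨u, v, huv⟩ := hflow φ hφ
    refine ⟨u, v, fun t ht => ?_⟩
    obtain ⟨hu, hv, hderiv⟩ := huv t ht
    exact ⟨(mem_graph_closure_onFock (hy t) (hsymm t) (hT t)).2 hu,
      Submodule.topologicalClosure_mono (graph_onFock_lie_lie_le x (y t))
        (mem_topologicalClosure_graph_onFock ((hy t).lie ((hy t).lie hx)) (hTS t) hv), hderiv⟩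

end LocalFlow

section TwoModes

theorem twoModeCoeff_mem_cutoffTame (ω β : ℝ) : twoModeCoeff ω β ∈ cutoffTame (Fin 2) :=
  quadraticExpr_eq_twoModeCoeff ω β ▸ quadraticExpr_mem_cutoffTame _ _ _

theorem isHermitian_diagonal_fin_two (ω : ℝ) :
    (!![(ω : ℂ), 0; 0, (ω : ℂ)] : Matrix (Fin 2) (Fin 2) ℂ).IsHermitian := by
  ext k l
  fin_cases k <;> fin_cases l <;> simp

theorem isSelfAdjoint_closure_twoModeOp (ω β : ℝ) :
    IsSelfAdjoint (twoModeOp ω ω β ω).closure :=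
  isSelfAdjoint_closure_quadraticOp (isHermitian_diagonal_fin_two ω) _ ω

theorem mem_graph_closure_twoModeOp {ω β : ℝ} {φ ψ : BosonFock (Fin 2)} :
    (φ, ψ) ∈ (twoModeOp ω ω β ω).closure.graph ↔
      (ψ : (Fin 2 → ℕ) → ℂ) = twoModeCoeff ω β φ := by
  rw [← quadraticExpr_eq_twoModeCoeff]
  exact mem_graph_closure_quadraticOp (isHermitian_diagonal_fin_two ω)

theorem pairCoeff_apply (k : Fin 2) (f : (Fin 2 → ℕ) → ℂ) (n : Fin 2 → ℕ) :
    pairCoeff f n = (√(n k + 1) : ℂ) * √(n (k + 1) + 1) * f (n + 1) +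
      (√(n k) : ℂ) * √(n (k + 1)) * f (n - 1) := by
  have hadd : n + Pi.single 0 1 + Pi.single 1 1 = n + 1 := by
    ext i
    fin_cases i <;> simp
  have hsub : n - Pi.single 0 1 - Pi.single 1 1 = n - 1 := by
    ext i
    fin_cases i <;> simp
  have h : pairCoeff f n = (√(n 0 + 1) : ℂ) * √(n 1 + 1) * f (n + 1) +
      (√(n 0) : ℂ) * √(n 1) * f (n - 1) := by
    change annihilateCoeff 0 (annihilateCoeff 1 f) n + createCoeff 0 (createCoeff 1 f) n = _
    simp [annihilateCoeff_apply, createCoeff_apply, hadd, hsub, mul_assoc]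
  fin_cases k
  · exact h
  · exact h.trans (by simp [mul_comm])

theorem twoModeCoeff_apply (ω β : ℝ) (f : (Fin 2 → ℕ) → ℂ) :
    twoModeCoeff ω β f = (ω : ℂ) • (numberCoeff (Fin 2) f + f) + (2 * β : ℂ) • pairCoeff f := rfl

theorem isUnbounded_closure_twoModeOp {ω β : ℝ} (h : β ≠ 0) :
    (twoModeOp ω ω β ω).closure.IsUnbounded := by
  refine isUnbounded_closure_onFock (actsBy_quadraticExpr _ _ _) fun C => ?_
  obtain ⟨m, hm⟩ := exists_nat_gt (C / |2 * β|)
  set n : Fin 2 → ℕ := fun _ => m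
  refine ⟨n, n + 1, ?_⟩
  have hzero : (Pi.single n 1 : (Fin 2 → ℕ) → ℂ) (n + 1 + 1) = 0 :=
    Pi.single_eq_of_ne (fun h => by simpa [n, add_assoc] using congrFun h 0) _
  have hsqrt : (√(m + 1) : ℂ) * √(m + 1) = m + 1 := by
    rw [← Complex.ofReal_mul, Real.mul_self_sqrt (by positivity)]
    simp
  have hval : twoModeCoeff ω β (Pi.single n 1) (n + 1) = ((2 * β * (m + 1) : ℝ) : ℂ) := by
    simp [twoModeCoeff_apply, numberCoeff_apply, numberMul, pairCoeff_apply 0, hzero, hsqrt, n]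
  rw [quadraticExpr_eq_twoModeCoeff, hval, Complex.norm_real, Real.norm_eq_abs, abs_mul,
    abs_of_pos (by positivity : (0 : ℝ) < m + 1)]
  rw [div_lt_iff₀ (by positivity)] at hm
  nlinarith [abs_nonneg (2 * β)]

theorem isLocalFlow_twoModeOp {ω β : ℝ → ℝ} {τ : ℝ} {D : Submodule ℂ (BosonFock (Fin 2))}
    (hD : finiteParticle (Fin 2) ≤ D)
    (hflow : ∀ φ ∈ D, ∃ u v : ℝ → BosonFock (Fin 2), ∀ t ∈ Set.Ico 0 τ,
      (u t : (Fin 2 → ℕ) → ℂ) = twoModeCoeff (ω t) (β t) φ ∧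
      (v t : (Fin 2 → ℕ) → ℂ) = twoModeCoeff (-16 * β t ^ 2) (-4 * ω t * β t) φ ∧
      HasDerivWithinAt u (v t) (Set.Ico 0 τ) t) :
    IsLocalFlow (numberOp (Fin 2)).closure
      (fun t => (twoModeOp (ω t) (ω t) (β t) (ω t)).closure) τ (finiteParticle (Fin 2)) D := by
  refine isLocalFlow_closure_onFock actsBy_numberCoeff
    (T := fun t => twoModeCoeff (ω t) (β t)) (fun t => ?_)
    (fun t => isSymmetric_quadraticExpr (isHermitian_diagonal_fin_two (ω t)) _ _)
    (fun t => twoModeCoeff_mem_cutoffTame _ _) (fun t => ?_) hD ?_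
  · rw [← quadraticExpr_eq_twoModeCoeff]
    exact actsBy_quadraticExpr _ _ _
  · rw [lie_lie_twoModeCoeff]
    exact twoModeCoeff_mem_cutoffTame _ _
  · simpa only [lie_lie_twoModeCoeff] using hflow

theorem memℓp_pairCoeff {f : (Fin 2 → ℕ) → ℂ} (hf : HasMoment 2 f) : Memℓp (pairCoeff f) 2 := by
  have hA := (isGraded_annihilateCoeff (0 : Fin 2)).mul (isGraded_annihilateCoeff 1)
  have hB := (isGraded_createCoeff (0 : Fin 2)).mul (isGraded_createCoeff 1)
  exact (hasMoment_zero_iff.1 (hA.hasMoment hf)).add (hasMoment_zero_iff.1 (hB.hasMoment hf))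

end TwoModes

section Kernel

theorem sqrt_mul_succ_eq_of_recursion {s : ℕ → ℂ} {d : ℕ}
    (h : ∀ m : ℕ, (√(m + 1) : ℂ) * √(m + 1 + d) * s (m + 1) + (√m : ℂ) * √(m + d) * s (m - 1) =
      (2 * m + d + 1) * s m) (m : ℕ) :
    (√(m + 1) : ℂ) * s (m + 1) = (√(m + 1 + d) : ℂ) * s m := by
  have hsq {x : ℝ} (hx : 0 ≤ x) : (√x : ℂ) * √x = x := by
    rw [← Complex.ofReal_mul, Real.mul_self_sqrt hx]
  have hne (m : ℕ) : (√(m + 1 + d) : ℂ) ≠ 0 :=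
    Complex.ofReal_ne_zero.2 (Real.sqrt_pos.2 (by positivity)).ne'
  have hd (m : ℕ) := hsq (by positivity : (0 : ℝ) ≤ m + 1 + d)
  refine mul_left_cancel₀ (hne m) ?_
  induction m with
  | zero =>
    have h₀ := h 0
    have h₁ := hd 0
    push_cast [Real.sqrt_zero] at h₀ h₁ ⊢
    linear_combination h₀ - s 0 * h₁
  | succ m ih =>
    have hm := h (m + 1)
    have h₁ := hd (m + 1)
    have h₂ := hsq (by positivity : (0 : ℝ) ≤ m + 1)
    have ih := mul_left_cancel₀ (hne m) ih
    push_cast [Nat.add_sub_cancel] at hm h₁ h₂ ih ⊢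
    linear_combination hm - s (m + 1) * (h₁ + h₂) + (√(m + 1) : ℂ) * ih

theorem eq_zero_of_recursion_of_tendsto {s : ℕ → ℂ} {d : ℕ} (hs : Tendsto s atTop (𝓝 0))
    (h : ∀ m : ℕ, (√(m + 1) : ℂ) * √(m + 1 + d) * s (m + 1) + (√m : ℂ) * √(m + d) * s (m - 1) =
      (2 * m + d + 1) * s m) (m : ℕ) : s m = 0 := by
  have hmono : Monotone fun m => ‖s m‖ := by
    refine monotone_nat_of_le_succ fun m => ?_
    have hstep := congrArg norm (sqrt_mul_succ_eq_of_recursion h m)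
    simp only [norm_mul, Complex.norm_real, Real.norm_of_nonneg (Real.sqrt_nonneg _)] at hstep
    refine le_of_mul_le_mul_left ?_ (by positivity : 0 < √((m : ℝ) + 1))
    rw [hstep]
    exact mul_le_mul_of_nonneg_right (Real.sqrt_le_sqrt (by simp)) (norm_nonneg _)
  exact norm_le_zero_iff.1 (hmono.ge_of_tendsto (tendsto_zero_iff_norm_tendsto_zero.1 hs) m)

theorem sum_fin_two_eq_add_succ {M : Type*} [AddCommMonoid M] (f : Fin 2 → M) (j : Fin 2) :
    ∑ k, f k = f j + f (j + 1) := by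
  fin_cases j <;> simp [add_comm]

theorem eq_zero_of_pairCoeff_eq {φ : BosonFock (Fin 2)}
    (h : pairCoeff φ = numberCoeff (Fin 2) φ + φ) : φ = 0 := by
  refine lp.ext (funext fun n => ?_)
  obtain ⟨j, hj⟩ := Finite.exists_min n
  set d := n (j + 1) - n j
  -- The states with occupation number difference `d` that pair creation and annihilation connect
  -- to `n`; the mode `j` holds `m` particles.
  let e (m : ℕ) : Fin 2 → ℕ := fun k => n k - n j + m
  have hej (m : ℕ) : e m j = m := by simp [e]
  have hne : e (n j) = n := funext fun k => Nat.sub_add_cancel (hj k)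
  have hlim : Tendsto (fun m => φ (e m)) atTop (𝓝 0) := by
    have he : Function.Injective e := fun a b hab => by simpa [hej] using congrFun hab j
    rw [← Nat.cofinite_eq_atTop]
    exact tendsto_zero_iff_norm_tendsto_zero.2
      ((tendsto_norm_lp_cofinite (by norm_num) φ).comp he.tendsto_cofinite)
  rw [← hne]
  refine eq_zero_of_recursion_of_tendsto (d := d) hlim (fun m => ?_) (n j)
  have hej' : e m (j + 1) = m + d := Nat.add_comm _ _
  have hsucc : e m + 1 = e (m + 1) := rfl
  have hpred : (√m : ℂ) * √((m + d : ℕ) : ℝ) * φ (e m - 1) =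
      (√m : ℂ) * √((m + d : ℕ) : ℝ) * φ (e (m - 1)) := by
    rcases m with - | m
    · simp
    · rfl
  have hm := congrFun h (e m)
  rw [pairCoeff_apply j, hej, hej', hsucc, hpred, Pi.add_apply, numberCoeff_apply, numberMul, id,
    sum_fin_two_eq_add_succ _ j, hej, hej'] at hm
  push_cast [add_right_comm _ (d : ℝ)] at hm
  linear_combination hm

end Kernel

section Solutions

theorem tendsto_norm_smul_atTop {α E : Type*} [NormedAddCommGroup E] [NormedSpace ℝ E]
    {l : Filter α} {r : α → ℝ} {x : α → E} {x₀ : E} (hr : Tendsto r l atTop)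
    (hx : Tendsto x l (𝓝 x₀)) (h₀ : x₀ ≠ 0) : Tendsto (fun t => ‖r t • x t‖) l atTop := by
  simp only [norm_smul]
  exact (tendsto_norm_atTop_atTop.comp hr).atTop_mul_pos (norm_pos_iff.2 h₀) hx.norm

theorem add_eq_twoModeCoeff {φ a k : BosonFock (Fin 2)}
    (ha : (a : (Fin 2 → ℕ) → ℂ) = numberCoeff (Fin 2) φ + φ)
    (hk : (k : (Fin 2 → ℕ) → ℂ) = pairCoeff φ) (ω β : ℝ) :
    ((ω • a + (2 * β) • k : BosonFock (Fin 2)) : (Fin 2 → ℕ) → ℂ) = twoModeCoeff ω β φ := by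
  rw [twoModeCoeff_apply, ← ha, ← hk, lp.coeFn_add, lp.coeFn_smul, lp.coeFn_smul]
  ext n
  simp

section Parabolic

theorem smul_eq_twoModeCoeff {φ a : BosonFock (Fin 2)}
    (ha : (a : (Fin 2 → ℕ) → ℂ) = pairCoeff φ - (numberCoeff (Fin 2) φ + φ)) (r : ℝ) :
    ((r • a : BosonFock (Fin 2)) : (Fin 2 → ℕ) → ℂ) = twoModeCoeff (-r) (r / 2) φ := by
  rw [lp.coeFn_smul, ha]
  ext n
  simp only [twoModeCoeff_apply, Pi.smul_apply, Pi.add_apply, Pi.sub_apply, smul_eq_mul,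
    Complex.real_smul]
  push_cast
  ring

/-- The closure of `r (a₀ a₁ + a₀^* a₁^* - N - 1)`. With `r` depending on time, these operators are
the solutions of the flow on which the conserved quantity `ω ^ 2 - 4 β ^ 2` vanishes. -/
noncomputable def parabolicOp (r : ℝ) : BosonFock (Fin 2) →ₗ.[ℂ] BosonFock (Fin 2) :=
  (twoModeOp (-r) (-r) (r / 2) (-r)).closure

theorem mem_domain_parabolicOp {r : ℝ} (hr : r ≠ 0) {φ : BosonFock (Fin 2)} :
    φ ∈ (parabolicOp r).domain ↔
      ∃ a : BosonFock (Fin 2),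
        (a : (Fin 2 → ℕ) → ℂ) = pairCoeff φ - (numberCoeff (Fin 2) φ + φ) := by
  rw [LinearPMap.mem_domain_iff]
  constructor
  · rintro ⟨ψ, hψ⟩
    refine ⟨r⁻¹ • ψ, ?_⟩
    rw [lp.coeFn_smul, mem_graph_closure_twoModeOp.1 hψ]
    ext n
    have hr' : (r : ℂ) ≠ 0 := Complex.ofReal_ne_zero.2 hr
    simp only [twoModeCoeff_apply, Pi.smul_apply, Pi.add_apply, Pi.sub_apply, smul_eq_mul,
    Complex.real_smul]
    push_cast
    field_simp
    ring
  · rintro ⟨a, ha⟩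
    exact ⟨r • a, mem_graph_closure_twoModeOp.2 (smul_eq_twoModeCoeff ha r)⟩

theorem domain_parabolicOp {r s : ℝ} (hr : r ≠ 0) (hs : s ≠ 0) :
    (parabolicOp r).domain = (parabolicOp s).domain := by
  ext φ
  rw [mem_domain_parabolicOp hr, mem_domain_parabolicOp hs]

/-- The solution of `r' = 4 r ^ 2` that blows up at time `1`. -/
noncomputable def parabolicRate (t : ℝ) : ℝ := (4 * (1 - t))⁻¹

theorem parabolicRate_pos {t : ℝ} (ht : t < 1) : 0 < parabolicRate t :=
  inv_pos.2 (by linarith)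

theorem hasDerivAt_parabolicRate {t : ℝ} (ht : t < 1) :
    HasDerivAt parabolicRate (4 * parabolicRate t ^ 2) t := by
  have h₁ : 1 - t ≠ 0 := (sub_pos.2 ht).ne'
  have h := (((hasDerivAt_id t).const_sub 1).const_mul 4).inv (mul_ne_zero four_ne_zero h₁)
  refine h.congr_deriv ?_
  simp only [parabolicRate, id]
  field_simp

theorem tendsto_parabolicRate : Tendsto parabolicRate (𝓝[<] 1) atTop := by
  refine tendsto_inv_nhdsGT_zero.comp (tendsto_nhdsWithin_iff.2 ⟨?_, ?_⟩)
  · have h : Tendsto (fun t : ℝ => 4 * (1 - t)) (𝓝 1) (𝓝 (4 * (1 - 1))) :=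
      Continuous.tendsto (by fun_prop) 1
    simpa using h.mono_left nhdsWithin_le_nhds
  · filter_upwards [self_mem_nhdsWithin] with t (ht : t < 1)
    simpa using ht

theorem isLocalFlow_parabolicOp :
    IsLocalFlow (numberOp (Fin 2)).closure (fun t => parabolicOp (parabolicRate t)) 1
      (finiteParticle (Fin 2)) (parabolicOp (parabolicRate 0)).domain := by
  have hr := (parabolicRate_pos one_pos).ne'
  refine isLocalFlow_twoModeOp (twoModeOp _ _ _ _).le_closure.1 fun φ hφ => ?_
  obtain ⟨a, ha⟩ := (mem_domain_parabolicOp hr).1 hφ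
  refine ⟨fun t => parabolicRate t • a, fun t => (4 * parabolicRate t ^ 2) • a, fun t ht =>
    ⟨smul_eq_twoModeCoeff ha _, ?_,
      ((hasDerivAt_parabolicRate ht.2).smul_const a).hasDerivWithinAt⟩⟩
  convert smul_eq_twoModeCoeff ha (4 * parabolicRate t ^ 2) using 3 <;> ring

theorem blowsUpOn_parabolicOp :
    BlowsUpOn (fun t => parabolicOp (parabolicRate t)) 1
      (parabolicOp (parabolicRate 0)).domain := by
  intro φ hφ hφ₀
  obtain ⟨a, ha⟩ := (mem_domain_parabolicOp (parabolicRate_pos one_pos).ne').1 hφ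
  refine ⟨fun t => parabolicRate t • a,
    fun t _ => mem_graph_closure_twoModeOp.2 (smul_eq_twoModeCoeff ha _),
    tendsto_norm_smul_atTop tendsto_parabolicRate tendsto_const_nhds fun h => hφ₀ ?_⟩
  rw [h] at ha
  exact eq_zero_of_pairCoeff_eq (sub_eq_zero.1 ha.symm)

end Parabolic

section Trigonometric

/-- The coefficient `ω` of `N + 1` in the solution of `ω' = -16 β ^ 2`, `β' = -4 ω β` with
`ω = 0` and `β = b` at time `0`. -/
noncomputable def trigonometricDiagonal (b t : ℝ) : ℝ := -2 * b * Real.tan (8 * b * t)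

/-- The coefficient `β` of the pair interaction in the solution of `ω' = -16 β ^ 2`,
`β' = -4 ω β` with `ω = 0` and `β = b` at time `0`. -/
noncomputable def trigonometricPairing (b t : ℝ) : ℝ := b * (Real.cos (8 * b * t))⁻¹

variable {b t : ℝ}

theorem cos_pos_of_mem_Ico (hb : 0 < b) (ht : t ∈ Set.Ico 0 (Real.pi / (16 * b))) :
    0 < Real.cos (8 * b * t) := by
  have h := (lt_div_iff₀ (by positivity)).1 ht.2
  have h₀ : 0 ≤ b * t := mul_nonneg hb.le ht.1
  exact Real.cos_pos_of_mem_Ioo ⟨by linarith [Real.pi_pos], by linarith⟩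

theorem trigonometricPairing_pos (hb : 0 < b) (ht : t ∈ Set.Ico 0 (Real.pi / (16 * b))) :
    0 < trigonometricPairing b t :=
  mul_pos hb (inv_pos.2 (cos_pos_of_mem_Ico hb ht))

theorem hasDerivAt_trigonometricDiagonal (h : Real.cos (8 * b * t) ≠ 0) :
    HasDerivAt (trigonometricDiagonal b) (-16 * trigonometricPairing b t ^ 2) t := by
  have hlin : HasDerivAt (fun t => 8 * b * t) (8 * b) t := by
    simpa using (hasDerivAt_id t).const_mul (8 * b)
  refine (((Real.hasDerivAt_tan h).comp t hlin).const_mul (-2 * b)).congr_deriv ?_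
  rw [trigonometricPairing]
  field_simp
  ring

theorem hasDerivAt_trigonometricPairing (h : Real.cos (8 * b * t) ≠ 0) :
    HasDerivAt (trigonometricPairing b)
      (-4 * trigonometricDiagonal b t * trigonometricPairing b t) t := by
  have hlin : HasDerivAt (fun t => 8 * b * t) (8 * b) t := by
    simpa using (hasDerivAt_id t).const_mul (8 * b)
  refine ((hlin.cos.inv h).const_mul b).congr_deriv ?_
  rw [trigonometricPairing, trigonometricDiagonal, Real.tan_eq_sin_div_cos]
  field_simp
  ring

theorem tendsto_eight_mul_mul (hb : b ≠ 0) :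
    Tendsto (fun t => 8 * b * t) (𝓝[<] (Real.pi / (16 * b))) (𝓝 (Real.pi / 2)) := by
  have h : 8 * b * (Real.pi / (16 * b)) = Real.pi / 2 := by
    field_simp
    norm_num
  exact h ▸ (Continuous.tendsto (by fun_prop) _).mono_left nhdsWithin_le_nhds

theorem tendsto_trigonometricPairing (hb : 0 < b) :
    Tendsto (trigonometricPairing b) (𝓝[<] (Real.pi / (16 * b))) atTop := by
  refine Tendsto.const_mul_atTop hb
    (tendsto_inv_nhdsGT_zero.comp (tendsto_nhdsWithin_iff.2 ⟨?_, ?_⟩))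
  · have h := (Real.continuous_cos.tendsto _).comp (tendsto_eight_mul_mul hb.ne')
    rwa [Real.cos_pi_div_two] at h
  · filter_upwards [Ico_mem_nhdsLT (by positivity : (0 : ℝ) < Real.pi / (16 * b))] with t ht
    exact cos_pos_of_mem_Ico hb ht

theorem smul_add_smul_trigonometric {E : Type*} [AddCommGroup E] [Module ℝ E] (b t : ℝ)
    (a k : E) :
    trigonometricDiagonal b t • a + (2 * trigonometricPairing b t) • k =
      (2 * trigonometricPairing b t) • (k - Real.sin (8 * b * t) • a) := by
  rw [trigonometricPairing, trigonometricDiagonal, Real.tan_eq_sin_div_cos]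
  module

theorem exists_pairCoeff_of_mem_domain {φ : BosonFock (Fin 2)}
    (hφ : φ ∈ (numberOp (Fin 2)).closure.domain) :
    ∃ a k : BosonFock (Fin 2), (a : (Fin 2 → ℕ) → ℂ) = numberCoeff (Fin 2) φ + φ ∧
      (k : (Fin 2 → ℕ) → ℂ) = pairCoeff φ := by
  obtain ⟨ψ, hψ⟩ := LinearPMap.mem_domain_iff.1 hφ
  refine ⟨ψ + φ, ⟨_, memℓp_pairCoeff (hasMoment_two_of_mem_domain_closure_numberOp hφ)⟩, ?_, rfl⟩
  rw [lp.coeFn_add, mem_graph_closure_numberOp.1 hψ, numberCoeff_apply]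

/-- The solution of the two-mode example at time `t`. -/
noncomputable def trigonometricOp (b t : ℝ) : BosonFock (Fin 2) →ₗ.[ℂ] BosonFock (Fin 2) :=
  (twoModeOp (trigonometricDiagonal b t) (trigonometricDiagonal b t) (trigonometricPairing b t)
    (trigonometricDiagonal b t)).closure

theorem isLocalFlow_trigonometricOp (hb : 0 < b) :
    IsLocalFlow (numberOp (Fin 2)).closure (trigonometricOp b) (Real.pi / (16 * b))
      (finiteParticle (Fin 2)) (numberOp (Fin 2)).closure.domain := by
  refine isLocalFlow_twoModeOp (numberOp (Fin 2)).le_closure.1 fun φ hφ => ?_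
  obtain ⟨a, k, ha, hk⟩ := exists_pairCoeff_of_mem_domain hφ
  refine ⟨_, _, fun t ht => ⟨add_eq_twoModeCoeff ha hk _ _, add_eq_twoModeCoeff ha hk _ _, ?_⟩⟩
  have hcos := (cos_pos_of_mem_Ico hb ht).ne'
  exact (((hasDerivAt_trigonometricDiagonal hcos).smul_const a).add
    (((hasDerivAt_trigonometricPairing hcos).const_mul 2).smul_const k)).hasDerivWithinAt

theorem blowsUpOn_trigonometricOp (hb : 0 < b) :
    BlowsUpOn (trigonometricOp b) (Real.pi / (16 * b)) (numberOp (Fin 2)).closure.domain := by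
  intro φ hφ hφ₀
  obtain ⟨a, k, ha, hk⟩ := exists_pairCoeff_of_mem_domain hφ
  refine ⟨_, fun t _ => mem_graph_closure_twoModeOp.2 (add_eq_twoModeCoeff ha hk _ _), ?_⟩
  have hlim : Tendsto (fun t => k - Real.sin (8 * b * t) • a) (𝓝[<] (Real.pi / (16 * b)))
      (𝓝 (k - a)) := by
    have hsin := (Real.continuous_sin.tendsto _).comp (tendsto_eight_mul_mul hb.ne')
    simpa using tendsto_const_nhds.sub (hsin.smul_const a)
  simp only [smul_add_smul_trigonometric]
  refine tendsto_norm_smul_atTop ((tendsto_trigonometricPairing hb).const_mul_atTop two_pos) hlim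
    fun h => hφ₀ (eq_zero_of_pairCoeff_eq ?_)
  rw [← ha, ← hk, sub_eq_zero.1 h]

end Trigonometric

end Solutions

theorem mainTheorem9 :
    (∃ (F : Type) (_ : NormedAddCommGroup F) (_ : InnerProductSpace ℂ F) (_ : CompleteSpace F)
      (_ : TopologicalSpace.SeparableSpace F)
      (X : F →ₗ.[ℂ] F) (Y : ℝ → F →ₗ.[ℂ] F) (T : ℝ) (C : Submodule ℂ F),
      0 < T ∧
      IsSelfAdjoint X ∧ X.IsNonneg ∧ X.IsUnbounded ∧
      (∀ t ∈ Set.Ico 0 T, IsSelfAdjoint (Y t) ∧ (Y t).IsUnbounded ∧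
        (Y t).domain = (Y 0).domain) ∧
      IsLocalFlow X Y T C (Y 0).domain ∧
      BlowsUpOn Y T (Y 0).domain) ∧
    (∀ b : ℝ, 0 < b →
      ∃ ω₁ ω₂ β c : ℝ → ℝ, ∃ (X : BosonFock (Fin 2) →ₗ.[ℂ] BosonFock (Fin 2))
        (Y : ℝ → BosonFock (Fin 2) →ₗ.[ℂ] BosonFock (Fin 2)) (T : ℝ),
        T = Real.pi / (16 * b) ∧
        X = (numberOp (Fin 2)).closure ∧
        (∀ t, Y t = (twoModeOp (ω₁ t) (ω₂ t) (β t) (c t)).closure) ∧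
        ω₁ 0 = 0 ∧ ω₂ 0 = 0 ∧ β 0 = b ∧ c 0 = 0 ∧
        IsSelfAdjoint X ∧ X.IsNonneg ∧ X.IsUnbounded ∧
        (∀ t ∈ Set.Ico 0 T, IsSelfAdjoint (Y t) ∧ (Y t).IsUnbounded) ∧
        IsLocalFlow X Y T (finiteParticle (Fin 2)) X.domain ∧
        BlowsUpOn Y T X.domain) := by
  refine ⟨⟨BosonFock (Fin 2), inferInstance, inferInstance, inferInstance,
    separableSpace_lp (by norm_num), (numberOp (Fin 2)).closure,
    fun t => parabolicOp (parabolicRate t), 1, finiteParticle (Fin 2), one_pos,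
    isSelfAdjoint_closure_numberOp, isNonneg_closure_numberOp, isUnbounded_closure_numberOp,
    fun t ht => ?_, isLocalFlow_parabolicOp, blowsUpOn_parabolicOp⟩,
    fun b hb => ⟨trigonometricDiagonal b, trigonometricDiagonal b, trigonometricPairing b,
      trigonometricDiagonal b, (numberOp (Fin 2)).closure, trigonometricOp b,
      Real.pi / (16 * b), rfl, rfl, fun _ => rfl, ?_, ?_, ?_, ?_,
      isSelfAdjoint_closure_numberOp, isNonneg_closure_numberOp, isUnbounded_closure_numberOp,
      fun t ht => ⟨isSelfAdjoint_closure_twoModeOp _ _,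
        isUnbounded_closure_twoModeOp (trigonometricPairing_pos hb ht).ne'⟩,
      isLocalFlow_trigonometricOp hb, blowsUpOn_trigonometricOp hb⟩⟩
  · have hr := (parabolicRate_pos ht.2).ne'
    exact ⟨isSelfAdjoint_closure_twoModeOp _ _,
      isUnbounded_closure_twoModeOp (div_ne_zero hr two_ne_zero),
      domain_parabolicOp hr (parabolicRate_pos one_pos).ne'⟩
  all_goals simp [trigonometricDiagonal, trigonometricPairing]
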